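/- **Theorem 1 (Global convergence rate of Cubic-GDA).** Let $m,n\ge 1$, $L_1,L_2,\mu>0$, and let $f:\mathbb R^m\times\mathbb R^n\to\mathbb R$ be twice continuously differentiable such that: (1) $\nabla f$ is $L_1$-Lipschitz and $f(x,\cdot)$ is $\mu$-strongly concave for every $x$; (2) the Jacobian blocks $\nabla_{11}f,\nabla_{12}f,\nabla_{21}f,\nabla_{22}f$ are $L_2$-Lipschitz (spectral norm); (3) $\Phi(x)=\max_y f(x,y)$ is bounded below and has compact sub-level sets. Write $\kappa=L_1/\mu$, $L_G=L_2(1+\kappa)^2$, $L_\Phi=L_2(1+\kappa)^3$, $y^*(x)=\arg\max_y f(x,y)$, $\Phi^*=\min\Phi$, and $G=\nabla_{11}f-\nabla_{12}f(\nabla_{22}f)^{-1}\nabla_{21}f$. Cubic-GDA with step sizes $\eta_x,\eta_y$, threshold $\epsilon'$ and start $(x_0,y_0)$ performs, for $t=0,\dots,T-1$: obtain $y_{t+1}$ from $y_t$ by $N_t$ gradient ascent steps $\widetilde y\leftarrow\widetilde y+\eta_y\nabla_2 f(x_t,\widetilde y)$; take any global minimizer $s_{t+1}$ of $s\mapsto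 \nabla_1 f(x_t,y_{t+1})^\top s+\frac12 s^\top G(x_t,y_{t+1})s+\frac1{6\eta_x}\|s\|^3$; set $x_{t+1}=x_t+s_{t+1}$. With the convention $\|s_0\|=\epsilon'$, its output index is $T'=\min\{t\ge 1:\ \max(\|s_{t-1}\|,\|s_t\|)\le\epsilon'\}$. Let $0<\epsilon\le L_1\sqrt{33L_\Phi}/L_G$, $\epsilon'=\epsilon/\sqrt{33L_\Phi}$, $\frac1{56L_\Phi}\le\eta_x\le\frac1{55L_\Phi}$, $\eta_y=\frac{2}{L_1+\mu}$, $\Delta=\Phi(x_0)-\Phi^*$, $d_0=\|y_0-y^*(x_0)\|$, and $T\ge\frac{\Delta+8L_\Phi\epsilon'^2}{3L_\Phi\epsilon'^3}$. Set $\alpha=\beta=L_\Phi$ and suppose that, in every iteration $t<T$ reached before the stopping criterion is met, $N_t\ge R_t$, where $$R_0=\kappa\ln\frac{L_1 d_0}{2\beta\epsilon'^2},\qquad R_t=\kappa\ln\frac{2L_1\alpha\|s_{t-1}\|+L_1(\alpha+L_G\kappa)\|s_t\|}{L_G\,\beta\,\epsilon'^2}\quad(t\ge 1)$$ (no requirement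 at $t=0$ if $d_0=0$). Then $T'$ exists, $T'\le T$, and $$\max\Big(\sqrt{\|\nabla\Phi(x_{T'})\|},\ \frac{-\lambda_{\min}(\nabla^2\Phi(x_{T'}))}{\sqrt{33L_\Phi}}\Big)\le\epsilon .$$ Moreover there is an absolute constant $C>0$ such that the number of cubic iterations satisfies $$T'\le C\big(1+\Delta\,\sqrt{L_2}\,\kappa^{1.5}\epsilon^{-3}\big),$$ and, if each $N_t$ ($t<T'$) is the smallest natural number that is at least $R_t$, the total number of gradient ascent iterations satisfies $$\sum_{t=0}^{T'-1}N_t\le C\big(\kappa+\Delta\,\sqrt{L_2}\,\kappa^{2.5}\epsilon^{-3}\big)\,\ln\!\big(2+L_1+L_2^{-1}+\kappa+\epsilon^{-1}+\Delta+d_0\big).$$ In particular, as $\epsilon\to0$ these are $\mathcal O(\sqrt{L_2}\kappa^{1.5}\epsilon^{-3})$ and $\widetilde{\mathcal O}(\sqrt{L_2}\kappa^{2.5}\epsilon^{-3})$. -/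

import Mathlib

noncomputable section

namespace CubicGDA

/-- The Euclidean space of dimension `d`. -/
abbrev E (d : ℕ) := EuclideanSpace ℝ (Fin d)

variable {m n : ℕ}

/-- Euclidean distance between the pairs `(x, y)` and `(x', y')` in `ℝ^m × ℝ^n`. -/
def pairDist (x : E m) (y : E n) (x' : E m) (y' : E n) : ℝ :=
  Real.sqrt (‖x - x'‖ ^ 2 + ‖y - y'‖ ^ 2)

/-- Partial gradient in the first argument. -/
def grad1 (f : E m → E n → ℝ) (x : E m) (y : E n) : E m := gradient (fun u => f u y) x

/-- Partial gradient in the second argument. -/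
def grad2 (f : E m → E n → ℝ) (x : E m) (y : E n) : E n := gradient (fun v => f x v) y

/-- Jacobian in `x` of the partial gradient in `x`. -/
def hess11 (f : E m → E n → ℝ) (x : E m) (y : E n) : E m →L[ℝ] E m :=
  fderiv ℝ (fun u => grad1 f u y) x

/-- Jacobian in `y` of the partial gradient in `x`. -/
def hess12 (f : E m → E n → ℝ) (x : E m) (y : E n) : E n →L[ℝ] E m :=
  fderiv ℝ (fun v => grad1 f x v) y

/-- Jacobian in `x` of the partial gradient in `y`. -/
def hess21 (f : E m → E n → ℝ) (x : E m) (y : E n) : E m →L[ℝ] E n :=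
  fderiv ℝ (fun u => grad2 f u y) x

/-- Jacobian in `y` of the partial gradient in `y`. -/
def hess22 (f : E m → E n → ℝ) (x : E m) (y : E n) : E n →L[ℝ] E n :=
  fderiv ℝ (fun v => grad2 f x v) y

/-- The Schur complement `∇₁₁f - ∇₁₂f (∇₂₂f)⁻¹ ∇₂₁f`. -/
def schurG (f : E m → E n → ℝ) (x : E m) (y : E n) : E m →L[ℝ] E m :=
  hess11 f x y - (hess12 f x y).comp ((hess22 f x y).inverse.comp (hess21 f x y))

/-- The envelope `Φ(x) = max_y f(x, y)`. -/
def envelope (f : E m → E n → ℝ) (x : E m) : ℝ := ⨆ y : E n, f x y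

/-- The maximizer `y*(x)` of `f(x, ·)`. -/
def yStar (f : E m → E n → ℝ) (x : E m) : E n :=
  Classical.epsilon fun y => IsMaxOn (fun v => f x v) Set.univ y

/-- The optimal value `Φ* = min_x Φ(x)`. -/
def optVal (f : E m → E n → ℝ) : ℝ := ⨅ x : E m, envelope f x

/-- The standing assumptions on the nonconvex-strongly-concave problem `min_x max_y f(x, y)`. -/
structure Assumptions (f : E m → E n → ℝ) (L₁ L₂ μ : ℝ) : Prop where
  contDiff : ContDiff ℝ 2 (fun p : E m × E n => f p.1 p.2)
  /-- the joint gradient is `L₁`-Lipschitz -/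
  smooth : ∀ x y x' y',
    Real.sqrt (‖grad1 f x y - grad1 f x' y'‖ ^ 2 + ‖grad2 f x y - grad2 f x' y'‖ ^ 2)
      ≤ L₁ * pairDist x y x' y'
  strongConcave : ∀ x, StrongConcaveOn Set.univ μ (fun y => f x y)
  lip11 : ∀ x y x' y', ‖hess11 f x y - hess11 f x' y'‖ ≤ L₂ * pairDist x y x' y'
  lip12 : ∀ x y x' y', ‖hess12 f x y - hess12 f x' y'‖ ≤ L₂ * pairDist x y x' y'
  lip21 : ∀ x y x' y', ‖hess21 f x y - hess21 f x' y'‖ ≤ L₂ * pairDist x y x' y'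
  lip22 : ∀ x y x' y', ‖hess22 f x y - hess22 f x' y'‖ ≤ L₂ * pairDist x y x' y'
  bddBelow : BddBelow (Set.range (envelope f))
  compactSublevel : ∀ c : ℝ, IsCompact {x : E m | envelope f x ≤ c}

/-- `L_G = L₂ (1 + κ)²` with `κ = L₁ / μ`. -/
def LG (L₁ L₂ μ : ℝ) : ℝ := L₂ * (1 + L₁ / μ) ^ 2

/-- `L_Φ = L₂ (1 + κ)³` with `κ = L₁ / μ`. -/
def LPhi (L₁ L₂ μ : ℝ) : ℝ := L₂ * (1 + L₁ / μ) ^ 3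

/-- The smallest eigenvalue of an operator on `ℝ^m` (used for symmetric operators, `m ≥ 1`). -/
def lambdaMin (A : E m →L[ℝ] E m) : ℝ :=
  sInf {c : ℝ | Module.End.HasEigenvalue (A : E m →ₗ[ℝ] E m) c}

/-- The Hessian of a real function on `ℝ^m`, as the Jacobian of its gradient. -/
def hessian (φ : E m → ℝ) (x : E m) : E m →L[ℝ] E m := fderiv ℝ (gradient φ) x

/-- The second-order stationarity measure
`max (√‖∇Φ(x)‖) (-λ_min(∇²Φ(x)) / √(33 L))`. -/
def stationarity (f : E m → E n → ℝ) (L : ℝ) (x : E m) : ℝ :=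
  max (Real.sqrt ‖gradient (envelope f) x‖)
    (-lambdaMin (hessian (envelope f) x) / Real.sqrt (33 * L))

/-- One gradient ascent step on `f(x, ·)`. -/
def ascentStep (f : E m → E n → ℝ) (ηy : ℝ) (x : E m) (v : E n) : E n := v + ηy • grad2 f x v

/-- The objective of the cubic subproblem at `(x, y)`. -/
def cubicModel (f : E m → E n → ℝ) (ηx : ℝ) (x : E m) (y : E n) (s : E m) : ℝ :=
  inner ℝ (grad1 f x y) s + 1 / 2 * inner ℝ s (schurG f x y s) + 1 / (6 * ηx) * ‖s‖ ^ 3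

/-- `T` iterations of Cubic-GDA with `N t` inner ascent steps in iteration `t`; the cubic
subproblem may be solved by any of its global minimizers. The value `s 0` is not used. -/
structure IsRun (f : E m → E n → ℝ) (ηx ηy : ℝ) (N : ℕ → ℕ) (T : ℕ)
    (x : ℕ → E m) (y : ℕ → E n) (s : ℕ → E m) : Prop where
  ascent : ∀ t < T, y (t + 1) = (ascentStep f ηy (x t))^[N t] (y t)
  cubic : ∀ t < T, IsMinOn (cubicModel f ηx (x t) (y (t + 1))) Set.univ (s (t + 1))
  update : ∀ t < T, x (t + 1) = x t + s (t + 1)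

/-- The increment norms `‖s_t‖`, with the convention `‖s_0‖ = ε'`. -/
def stepNorm (ε' : ℝ) (s : ℕ → E m) : ℕ → ℝ
  | 0 => ε'
  | t + 1 => ‖s (t + 1)‖

/-- The stopping criterion `max ‖s_{t-1}‖ ‖s_t‖ ≤ ε'` holds at the index `t ≥ 1`. -/
def Stops (ε' : ℝ) (s : ℕ → E m) (t : ℕ) : Prop :=
  1 ≤ t ∧ max (stepNorm ε' s (t - 1)) (stepNorm ε' s t) ≤ ε'

/-- The number of inner ascent steps that is required in iteration `t`, where `d₀` is the initial
distance `‖y_0 - y*(x_0)‖` and `r t` is the increment norm `‖s_t‖`. -/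
def ascentReq (L₁ L₂ μ α β ε' d₀ : ℝ) (r : ℕ → ℝ) : ℕ → ℝ
  | 0 => L₁ / μ * Real.log (L₁ * d₀ / (2 * β * ε' ^ 2))
  | t + 1 => L₁ / μ * Real.log
      ((2 * L₁ * α * r t + L₁ * (α + LG L₁ L₂ μ * (L₁ / μ)) * r (t + 1)) /
        (LG L₁ L₂ μ * β * ε' ^ 2))

end CubicGDA

end

open Filter Topology

namespace CubicGDA

/-! ### Inner product spaces: Taylor remainders, cubic models, strong concavity. -/

section General

variable {V W : Type*} [NormedAddCommGroup V] [InnerProductSpace ℝ V]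
  [NormedAddCommGroup W] [NormedSpace ℝ W]

/-! Cubic-GDA is an inexact cubic-regularized Newton method on the envelope `Φ`. Strong concavity
makes `y*` Lipschitz with constant `κ`, and differentiating `∇₂f(x, y*(x)) = 0` gives its Jacobian.
Hence `∇Φ(x) = ∇₁f(x, y*(x))` and `∇²Φ(x) = G(x, y*(x))`, the latter `L_Φ`-Lipschitz. The cubic step
uses the same quantities at `(x_t, y_{t+1})`, so its error is controlled by `‖y_{t+1} - y*(x_t)‖`.

Gradient ascent contracts this distance by `exp(-1/κ)` per step. The count `R_t` is tuned so that
the gradient error is at most `L_Φ(‖s_t‖² + ε'²)` and the Hessian error at most `L_Φ(‖s_t‖ + ε')`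
(`inner_accuracy`). These errors involve the previous increment, not the one about to be computed.
The optimality conditions `cubic_first_order` and `cubic_second_order` then give a decrease of `Φ`
of order `L_Φ‖s_{t+1}‖³`, up to a fraction of `L_Φ(‖s_t‖³ + ε'³)` (`envelope_cubic_step_le`).

Before stopping, one of any two consecutive increments exceeds `ε'`, so the cubes of the increments
absorb both error terms, and their sum is at most `Δ/(8 L_Φ)` (`sum_cubes_le_of_descent`). This
bounds the number of iterations by a multiple of `Δ/(L_Φ ε'³)`. At the stopping index both relevant
increments are at most `ε'`, and the optimality conditions become the gradient and curvature bounds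
(`stationarity_le`). For the total cost, every argument of the logarithm in `R_t` is at most a fixed
power of the sum in the final logarithm, so each inner loop costs `O(κ log)`. -/

lemma norm_le_of_abs_inner_self_le {A : V →L[ℝ] V} {ρ : ℝ} (hA : (A : V →ₗ[ℝ] V).IsSymmetric)
    (hρ : 0 ≤ ρ) (h : ∀ v, |inner ℝ (A v) v| ≤ ρ * ‖v‖ ^ 2) : ‖A‖ ≤ ρ := by
  rw [ContinuousLinearMap.norm_eq_iSup_rayleighQuotient A hA]
  refine Real.iSup_le (fun v => ?_) hρ
  rw [ContinuousLinearMap.rayleighQuotient, ContinuousLinearMap.reApplyInnerSelf_apply, abs_div,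
    abs_of_nonneg (sq_nonneg ‖v‖)]
  exact div_le_of_le_mul₀ (sq_nonneg _) hρ (h v)

lemma hasDerivAt_line (x s : V) (t : ℝ) : HasDerivAt (fun t : ℝ => x + t • s) s t := by
  simpa using ((hasDerivAt_id t).smul_const s).const_add x

/-- Second-order remainder bound for a map with Lipschitz derivative. -/
lemma norm_sub_sub_le_of_lipschitz_fderiv {F : V → W} {F' : V → V →L[ℝ] W} {L : ℝ}
    (hF : ∀ x, HasFDerivAt F (F' x) x) (hL : ∀ x x', ‖F' x - F' x'‖ ≤ L * ‖x - x'‖) (x s : V) :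
    ‖F (x + s) - F x - F' x s‖ ≤ L / 2 * ‖s‖ ^ 2 := by
  have hd : ∀ t : ℝ, HasDerivAt (fun t : ℝ => F (x + t • s) - F x - t • F' x s)
      (F' (x + t • s) s - F' x s) t := by
    intro t
    have h1 := (hF (x + t • s)).comp_hasDerivAt t (hasDerivAt_line x s t)
    have h2 := (hasDerivAt_id t).smul_const (F' x s)
    exact ((h1.sub_const (F x)).sub h2).congr_deriv (by simp)
  have hB : ∀ t : ℝ, HasDerivAt (fun t : ℝ => L / 2 * ‖s‖ ^ 2 * t ^ 2) (L * ‖s‖ ^ 2 * t) t := by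
    intro t
    exact ((hasDerivAt_pow 2 t).const_mul (L / 2 * ‖s‖ ^ 2)).congr_deriv (by push_cast; ring)
  have := image_norm_le_of_norm_deriv_right_le_deriv_boundary (a := 0) (b := 1)
    (fun t _ => (hd t).continuousAt.continuousWithinAt) (fun t _ => (hd t).hasDerivWithinAt)
    (by simp) hB (fun t ht => ?_) (Set.right_mem_Icc.2 zero_le_one)
  · simpa using this
  · rw [← sub_apply]
    refine (ContinuousLinearMap.le_opNorm _ _).trans ?_
    refine (mul_le_mul_of_nonneg_right (hL _ _) (norm_nonneg _)).trans (le_of_eq ?_)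
    rw [add_sub_cancel_left, norm_smul, Real.norm_of_nonneg ht.1]
    ring

/-- Third-order upper bound for a function with Lipschitz Hessian. -/
lemma le_taylor_of_lipschitz_hessian {φ : V → ℝ} {g : V → V} {H : V → V →L[ℝ] V} {L : ℝ}
    (hφ : ∀ x, HasFDerivAt φ (innerSL ℝ (g x)) x)
    (hg : ∀ x, HasFDerivAt g (H x) x) (hL : ∀ x x', ‖H x - H x'‖ ≤ L * ‖x - x'‖) (x s : V) :
    φ (x + s) ≤ φ x + inner ℝ (g x) s + 1 / 2 * inner ℝ (H x s) s + L / 6 * ‖s‖ ^ 3 := by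
  have hd : ∀ t : ℝ, HasDerivAt
      (fun t : ℝ => φ (x + t • s) - φ x - t * inner ℝ (g x) s - 1 / 2 * inner ℝ (H x s) s * t ^ 2)
      (inner ℝ (g (x + t • s) - g x - H x (t • s)) s) t := by
    intro t
    have h1 := (hφ (x + t • s)).comp_hasDerivAt t (hasDerivAt_line x s t)
    have h2 := (hasDerivAt_id t).mul_const (inner ℝ (g x) s)
    have h3 := (hasDerivAt_pow 2 t).const_mul (1 / 2 * inner ℝ (H x s) s)
    refine (((h1.sub_const (φ x)).sub h2).sub h3).congr_deriv ?_
    simp [inner_sub_left, inner_smul_left]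
    ring
  have hB : ∀ t : ℝ, HasDerivAt (fun t : ℝ => L / 6 * ‖s‖ ^ 3 * t ^ 3)
      (L / 2 * ‖s‖ ^ 3 * t ^ 2) t := by
    intro t
    exact ((hasDerivAt_pow 3 t).const_mul (L / 6 * ‖s‖ ^ 3)).congr_deriv (by push_cast; ring)
  have := image_le_of_deriv_right_le_deriv_boundary (a := 0) (b := 1)
    (fun t _ => (hd t).continuousAt.continuousWithinAt) (fun t _ => (hd t).hasDerivWithinAt)
    (by simp) (fun t _ => (hB t).continuousAt.continuousWithinAt)
    (fun t _ => (hB t).hasDerivWithinAt) (fun t ht => ?_) (Set.right_mem_Icc.2 zero_le_one)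
  · simp at this
    linarith
  -- The derivative of the remainder along the segment is the first-order remainder of `g` paired
  -- with `s`, so the preceding lemma bounds it by `L / 2 * ‖s‖ ^ 3 * t ^ 2`.
  · refine (real_inner_le_norm _ _).trans ?_
    refine (mul_le_mul_of_nonneg_right
      (norm_sub_sub_le_of_lipschitz_fderiv hg hL x (t • s)) (norm_nonneg _)).trans (le_of_eq ?_)
    rw [norm_smul, Real.norm_of_nonneg ht.1]
    ring

/-! ### Optimality conditions at a global minimizer of the cubic model. -/

section Cubic

variable {g s : V} {A : V →L[ℝ] V} {c : ℝ}

/-- First-order optimality condition of the cubic model. -/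
lemma cubic_first_order (hA : (A : V →ₗ[ℝ] V).IsSymmetric)
    (hs : IsMinOn (fun u => inner ℝ g u + 1 / 2 * inner ℝ u (A u) + c * ‖u‖ ^ 3) Set.univ s) :
    g + A s + (3 * c * ‖s‖) • s = 0 := by
  have h1 : HasFDerivAt (fun u : V => inner ℝ g u) (innerSL ℝ g) s := (innerSL ℝ g).hasFDerivAt
  have h2 : HasFDerivAt (fun u : V => inner ℝ u (A u)) _ s :=
    (hasFDerivAt_id s).inner ℝ A.hasFDerivAt
  -- The cube of the norm is differentiable at the origin too, so `s = 0` needs no separate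
  -- treatment.
  have h3 : HasFDerivAt (fun u : V => ‖u‖ ^ 3) ((3 * ‖s‖) • innerSL ℝ s) s := by
    have := hasFDerivAt_norm_rpow s (p := 3) (by norm_num)
    convert this using 1
    · ext u; norm_cast
    · norm_num
  have hm := (hs.isLocalMin univ_mem).hasFDerivAt_eq_zero ((h1.add (h2.const_mul (1 / 2))).add
    (h3.const_mul c))
  refine ext_inner_right ℝ fun v => ?_
  have hv := DFunLike.congr_fun hm v
  have hsy : inner ℝ (A v) s = inner ℝ v (A s) := hA v s
  simp [fderivInnerCLM_apply] at hv
  rw [inner_add_left, inner_add_left, inner_smul_left, inner_zero_left, ← hv]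
  have h4 : inner ℝ s (A v) = inner ℝ v (A s) := by rw [real_inner_comm, hsy]
  have h5 : inner ℝ (A s) v = inner ℝ v (A s) := real_inner_comm _ _
  rw [h4, h5]
  simp
  ring

/-- Global second-order optimality condition of the cubic model. -/
lemma cubic_second_order (hA : (A : V →ₗ[ℝ] V).IsSymmetric)
    (hs : IsMinOn (fun u => inner ℝ g u + 1 / 2 * inner ℝ u (A u) + c * ‖u‖ ^ 3) Set.univ s)
    (w : V) : -(3 * c * ‖s‖) * ‖w‖ ^ 2 ≤ inner ℝ (A w) w := by
  have hfo := cubic_first_order hA hs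
  -- the quadratic form is nonnegative on differences of points of equal norm
  have key : ∀ u : V, ‖u‖ = ‖s‖ →
      0 ≤ inner ℝ (A (u - s)) (u - s) + 3 * c * ‖s‖ * ‖u - s‖ ^ 2 := by
    intro u hu
    -- At equal norms the cubic terms cancel. Eliminating `g` by the first-order condition turns the
    -- difference of the two model values into half of this quadratic form.
    have h := hs (Set.mem_univ u)
    simp only [Set.mem_ofPred_eq, hu] at h
    have hg : g = -(A s) - (3 * c * ‖s‖) • s := by
      rw [eq_sub_iff_add_eq, eq_neg_iff_add_eq_zero, ← hfo]; abel
    have hn : ‖u - s‖ ^ 2 = 2 * ‖s‖ ^ 2 - 2 * inner ℝ s u := by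
      rw [norm_sub_sq_real, hu, real_inner_comm]; ring
    have hsy : inner ℝ (A u) s = inner ℝ u (A s) := hA u s
    have h5 : inner ℝ (A s) u = inner ℝ u (A s) := real_inner_comm _ _
    have h6 : inner ℝ (A s) s = inner ℝ s (A s) := real_inner_comm _ _
    have h7 : inner ℝ (A u) u = inner ℝ u (A u) := real_inner_comm _ _
    rw [hg] at h
    simp only [inner_sub_left, inner_neg_left, inner_smul_left, h5, h6,
      real_inner_self_eq_norm_sq, conj_trivial] at h
    rw [hn]
    simp only [map_sub, inner_sub_left, inner_sub_right, hsy, h5, h6, h7]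
    nlinarith
  have refl : ∀ w : V, inner ℝ w s ≠ 0 → 0 ≤ inner ℝ (A w) w + 3 * c * ‖s‖ * ‖w‖ ^ 2 := by
    intro w hw
    have hw0 : w ≠ 0 := by rintro rfl; simp at hw
    have hwn : ‖w‖ ^ 2 ≠ 0 := by positivity
    -- Reflecting `s` in the hyperplane orthogonal to `w` preserves its norm and moves it by a
    -- nonzero multiple of `w`.
    set a : ℝ := -(2 * inner ℝ w s / ‖w‖ ^ 2) with ha
    have ha0 : a ≠ 0 := by rw [ha]; simp [hw, hw0]
    have hn : ‖s + a • w‖ = ‖s‖ := by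
      have : ‖s + a • w‖ ^ 2 = ‖s‖ ^ 2 := by
        rw [norm_add_sq_real, norm_smul, inner_smul_right, mul_pow, Real.norm_eq_abs, sq_abs,
          real_inner_comm]
        rw [ha]; field_simp; ring
      exact (sq_eq_sq₀ (norm_nonneg _) (norm_nonneg _)).1 this
    have := key _ hn
    rw [add_sub_cancel_left, map_smul, inner_smul_left, inner_smul_right, norm_smul, mul_pow,
      Real.norm_eq_abs, sq_abs] at this
    have h2 : 0 ≤ a ^ 2 * (inner ℝ (A w) w + 3 * c * ‖s‖ * ‖w‖ ^ 2) := by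
      simp at this; linarith
    exact nonneg_of_mul_nonneg_right h2 (by positivity)
  suffices 0 ≤ inner ℝ (A w) w + 3 * c * ‖s‖ * ‖w‖ ^ 2 by linarith
  -- Two cases escape the reflection. If `s = 0` then `g = 0`, and comparison with `t • w` as `t →
  -- 0` leaves the quadratic term. If `w` is orthogonal to `s ≠ 0`, then `w + t • s` is not, and `t
  -- → 0` gives the claim by continuity.
  by_cases hs0 : s = 0
  · subst hs0
    simp at hfo
    subst hfo
    by_contra! hneg
    simp at hneg
    have hq : ∀ t : ℝ, 0 < t → 0 ≤ 1 / 2 * inner ℝ (A w) w + t * (c * ‖w‖ ^ 3) := by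
      intro t ht
      have h := hs (Set.mem_univ (t • w))
      simp only [Set.mem_ofPred_eq, inner_zero_left, norm_zero, norm_smul, map_smul,
        inner_smul_left, inner_smul_right, Real.norm_of_nonneg ht.le, conj_trivial] at h
      rw [real_inner_comm] at h
      have : 0 ≤ t ^ 2 * (1 / 2 * inner ℝ (A w) w + t * (c * ‖w‖ ^ 3)) := by
        norm_num at h; linarith
      exact nonneg_of_mul_nonneg_right this (by positivity)
    have hlim : Tendsto (fun t : ℝ => 1 / 2 * inner ℝ (A w) w + t * (c * ‖w‖ ^ 3)) (𝓝[>] 0)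
        (𝓝 (1 / 2 * inner ℝ (A w) w + 0 * (c * ‖w‖ ^ 3))) := by
      refine tendsto_nhdsWithin_of_tendsto_nhds (Continuous.tendsto ?_ 0); fun_prop
    have := ge_of_tendsto hlim (eventually_nhdsWithin_of_forall fun t ht => hq t ht)
    linarith
  · by_cases hw : inner ℝ w s = 0
    · have hq : ∀ t : ℝ, t ≠ 0 →
          0 ≤ inner ℝ (A (w + t • s)) (w + t • s) + 3 * c * ‖s‖ * ‖w + t • s‖ ^ 2 := by
        intro t ht
        refine refl _ ?_
        rw [inner_add_left, hw, inner_smul_left, real_inner_self_eq_norm_sq]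
        simp [ht, hs0]
      have hlim : Tendsto (fun t : ℝ => inner ℝ (A (w + t • s)) (w + t • s)
          + 3 * c * ‖s‖ * ‖w + t • s‖ ^ 2) (𝓝[≠] 0)
          (𝓝 (inner ℝ (A (w + (0 : ℝ) • s)) (w + (0 : ℝ) • s)
          + 3 * c * ‖s‖ * ‖w + (0 : ℝ) • s‖ ^ 2)) := by
        refine tendsto_nhdsWithin_of_tendsto_nhds (Continuous.tendsto ?_ 0); fun_prop
      simpa using ge_of_tendsto hlim (eventually_nhdsWithin_of_forall fun t ht => hq t ht)
    · exact refl w hw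

end Cubic

/-- First-order upper bound of a strongly concave function. -/
lemma StrongConcaveOn.le_add_inner {φ : V → ℝ} {μ : ℝ} (hφ : StrongConcaveOn Set.univ μ φ)
    {g x : V} (hg : HasFDerivAt φ (innerSL ℝ g) x) (y : V) :
    φ y ≤ φ x + inner ℝ g (y - x) - μ / 2 * ‖y - x‖ ^ 2 := by
  have hd : HasDerivAt (fun t : ℝ => φ (x + t • (y - x))) (inner ℝ g (y - x)) 0 := by
    have h0 : HasFDerivAt φ (innerSL ℝ g) (x + (0 : ℝ) • (y - x)) := by simpa using hg
    exact h0.comp_hasDerivAt (0 : ℝ) (hasDerivAt_line x (y - x) 0)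
  have hslope := (hasDerivAt_iff_tendsto_slope.1 hd).mono_left
    (nhdsWithin_mono 0 (fun t (ht : (0 : ℝ) < t) => ht.ne') : 𝓝[>] (0 : ℝ) ≤ 𝓝[≠] 0)
  -- Strong concavity bounds the difference quotient from `x` towards `y` below by this expression;
  -- the limit `t → 0` compares it with the directional derivative.
  have hlim : Tendsto (fun t : ℝ => φ y - φ x + (1 - t) * (μ / 2 * ‖y - x‖ ^ 2)) (𝓝[>] 0)
      (𝓝 (φ y - φ x + (1 - 0) * (μ / 2 * ‖y - x‖ ^ 2))) := by
    refine tendsto_nhdsWithin_of_tendsto_nhds (Continuous.tendsto ?_ 0); fun_prop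
  have hmem : Set.Ioo (0 : ℝ) 1 ∈ 𝓝[>] (0 : ℝ) := Ioo_mem_nhdsGT one_pos
  have := le_of_tendsto_of_tendsto hlim hslope (by
    filter_upwards [hmem] with t ht
    have h := hφ.2 (Set.mem_univ x) (Set.mem_univ y) (sub_nonneg.2 ht.2.le) ht.1.le (by ring)
    have he : (1 - t) • x + t • y = x + t • (y - x) := by module
    rw [he, norm_sub_rev x y] at h
    simp only [smul_eq_mul] at h
    rw [slope_def_field, le_div_iff₀ (by simpa using ht.1)]
    simp only [zero_smul, add_zero, sub_zero]
    linarith)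
  linarith

/-- The gradient of a strongly concave function is strongly monotone decreasing. -/
lemma StrongConcaveOn.inner_sub_le {φ : V → ℝ} {μ : ℝ} (hφ : StrongConcaveOn Set.univ μ φ)
    {g : V → V} (hg : ∀ x, HasFDerivAt φ (innerSL ℝ (g x)) x) (x y : V) :
    inner ℝ (g y - g x) (y - x) ≤ -μ * ‖y - x‖ ^ 2 := by
  have h1 := StrongConcaveOn.le_add_inner hφ (hg x) y
  have h2 := StrongConcaveOn.le_add_inner hφ (hg y) x
  rw [norm_sub_rev x y, ← neg_sub y x, inner_neg_right] at h2
  rw [inner_sub_left]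
  linarith

/-- The Jacobian of the gradient of a strongly concave function is uniformly negative definite. -/
lemma StrongConcaveOn.inner_fderiv_le {φ : V → ℝ} {μ : ℝ} (hφ : StrongConcaveOn Set.univ μ φ)
    {g : V → V} (hg : ∀ x, HasFDerivAt φ (innerSL ℝ (g x)) x) {H : V →L[ℝ] V} {x : V}
    (hH : HasFDerivAt g H x) (v : V) : inner ℝ (H v) v ≤ -μ * ‖v‖ ^ 2 := by
  have hd : HasDerivAt (fun t : ℝ => inner ℝ (g (x + t • v)) v) (inner ℝ (H v) v) 0 := by
    have h0 : HasFDerivAt g H (x + (0 : ℝ) • v) := by simpa using hH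
    simpa using (h0.comp_hasDerivAt (0 : ℝ) (hasDerivAt_line x v 0)).inner ℝ
      (hasDerivAt_const (0 : ℝ) v)
  have hslope := (hasDerivAt_iff_tendsto_slope.1 hd).mono_left
    (nhdsWithin_mono 0 (fun t (ht : (0 : ℝ) < t) => ht.ne') : 𝓝[>] (0 : ℝ) ≤ 𝓝[≠] 0)
  refine le_of_tendsto hslope (eventually_nhdsWithin_of_forall fun t (ht : 0 < t) => ?_)
  have h := StrongConcaveOn.inner_sub_le hφ hg x (x + t • v)
  rw [add_sub_cancel_left, inner_smul_right, norm_smul, Real.norm_of_nonneg ht.le,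
    inner_sub_left] at h
  rw [slope_def_field, div_le_iff₀ (by simpa using ht)]
  simp only [zero_smul, add_zero, sub_zero]
  refine le_of_mul_le_mul_left (h.trans (le_of_eq ?_)) ht
  ring

end General

/-! ### Partial gradients, Hessian blocks and the Schur complement. -/

section Calculus

variable {m n : ℕ} {f : E m → E n → ℝ}

@[simp] lemma pairDist_same_fst (x : E m) (y y' : E n) : pairDist x y x y' = ‖y - y'‖ := by
  simp [pairDist]

@[simp] lemma pairDist_same_snd (x x' : E m) (y : E n) : pairDist x y x' y = ‖x - x'‖ := by
  simp [pairDist]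

lemma hasFDerivAt_inl (x : E m) (y : E n) :
    HasFDerivAt (fun u : E m => (u, y)) (ContinuousLinearMap.inl ℝ (E m) (E n)) x :=
  hasFDerivAt_prodMk_left x y

lemma hasFDerivAt_inr (x : E m) (y : E n) :
    HasFDerivAt (fun v : E n => (x, v)) (ContinuousLinearMap.inr ℝ (E m) (E n)) y :=
  hasFDerivAt_prodMk_right x y

section Regular

variable (hf : ContDiff ℝ 2 (fun p : E m × E n => f p.1 p.2))

include hf

lemma hasFDerivAt_uncurry (p : E m × E n) :
    HasFDerivAt (fun p : E m × E n => f p.1 p.2)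
      (fderiv ℝ (fun p : E m × E n => f p.1 p.2) p) p :=
  (hf.differentiable (by norm_num) p).hasFDerivAt

lemma hasFDerivAt_fst (x : E m) (y : E n) :
    HasFDerivAt (fun u => f u y) (innerSL ℝ (grad1 f x y)) x := by
  have h := (hasFDerivAt_uncurry hf (x, y)).comp x (hasFDerivAt_inl x y)
  have hd : DifferentiableAt ℝ (fun u => f u y) x := h.differentiableAt
  refine hd.hasFDerivAt.congr_fderiv ?_
  ext v
  simp [grad1]

lemma hasFDerivAt_snd (x : E m) (y : E n) :
    HasFDerivAt (fun v => f x v) (innerSL ℝ (grad2 f x y)) y := by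
  have h := (hasFDerivAt_uncurry hf (x, y)).comp y (hasFDerivAt_inr x y)
  have hd : DifferentiableAt ℝ (fun v => f x v) y := h.differentiableAt
  refine hd.hasFDerivAt.congr_fderiv ?_
  ext v
  simp [grad2]

lemma inner_grad1 (p : E m × E n) (u : E m) :
    inner ℝ (grad1 f p.1 p.2) u = fderiv ℝ (fun p : E m × E n => f p.1 p.2) p (u, 0) := by
  have h := (hasFDerivAt_uncurry hf p).comp p.1 (hasFDerivAt_inl p.1 p.2)
  have := DFunLike.congr_fun ((hasFDerivAt_fst hf p.1 p.2).unique h) u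
  simpa using this

lemma inner_grad2 (p : E m × E n) (v : E n) :
    inner ℝ (grad2 f p.1 p.2) v = fderiv ℝ (fun p : E m × E n => f p.1 p.2) p (0, v) := by
  have h := (hasFDerivAt_uncurry hf p).comp p.2 (hasFDerivAt_inr p.1 p.2)
  have := DFunLike.congr_fun ((hasFDerivAt_snd hf p.1 p.2).unique h) v
  simpa using this

lemma contDiff_fderiv_uncurry :
    ContDiff ℝ 1 (fderiv ℝ (fun p : E m × E n => f p.1 p.2)) :=
  hf.fderiv_right (by norm_num)

/-- Each coordinate of a partial gradient is the joint derivative evaluated at a fixed basis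
direction, so joint regularity is inherited coordinatewise. -/
lemma contDiff_grad1 : ContDiff ℝ 1 (fun p : E m × E n => grad1 f p.1 p.2) := by
  rw [contDiff_euclidean]
  intro i
  have : (fun p : E m × E n => (grad1 f p.1 p.2) i) = fun p =>
      fderiv ℝ (fun p : E m × E n => f p.1 p.2) p (EuclideanSpace.single i 1, 0) := by
    ext p
    rw [← inner_grad1 hf, EuclideanSpace.inner_single_right]
    simp
  rw [this]
  exact (contDiff_fderiv_uncurry hf).clm_apply contDiff_const

lemma contDiff_grad2 : ContDiff ℝ 1 (fun p : E m × E n => grad2 f p.1 p.2) := by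
  rw [contDiff_euclidean]
  intro i
  have : (fun p : E m × E n => (grad2 f p.1 p.2) i) = fun p =>
      fderiv ℝ (fun p : E m × E n => f p.1 p.2) p (0, EuclideanSpace.single i 1) := by
    ext p
    rw [← inner_grad2 hf, EuclideanSpace.inner_single_right]
    simp
  rw [this]
  exact (contDiff_fderiv_uncurry hf).clm_apply contDiff_const

lemma hasFDerivAt_fderiv_uncurry (p : E m × E n) :
    HasFDerivAt (fderiv ℝ (fun p : E m × E n => f p.1 p.2))
      (fderiv ℝ (fderiv ℝ (fun p : E m × E n => f p.1 p.2)) p) p :=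
  ((contDiff_fderiv_uncurry hf).differentiable (by norm_num) p).hasFDerivAt

lemma hasFDerivAt_grad1_fst (x : E m) (y : E n) :
    HasFDerivAt (fun u => grad1 f u y) (hess11 f x y) x :=
  (DifferentiableAt.comp (g := fun p : E m × E n => grad1 f p.1 p.2) x
    ((contDiff_grad1 hf).differentiable (by norm_num) (x, y))
    (hasFDerivAt_inl x y).differentiableAt).hasFDerivAt

lemma hasFDerivAt_grad1_snd (x : E m) (y : E n) :
    HasFDerivAt (fun v => grad1 f x v) (hess12 f x y) y :=
  (DifferentiableAt.comp (g := fun p : E m × E n => grad1 f p.1 p.2) y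
    ((contDiff_grad1 hf).differentiable (by norm_num) (x, y))
    (hasFDerivAt_inr x y).differentiableAt).hasFDerivAt

lemma hasFDerivAt_grad2_fst (x : E m) (y : E n) :
    HasFDerivAt (fun u => grad2 f u y) (hess21 f x y) x :=
  (DifferentiableAt.comp (g := fun p : E m × E n => grad2 f p.1 p.2) x
    ((contDiff_grad2 hf).differentiable (by norm_num) (x, y))
    (hasFDerivAt_inl x y).differentiableAt).hasFDerivAt

lemma hasFDerivAt_grad2_snd (x : E m) (y : E n) :
    HasFDerivAt (fun v => grad2 f x v) (hess22 f x y) y :=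
  (DifferentiableAt.comp (g := fun p : E m × E n => grad2 f p.1 p.2) y
    ((contDiff_grad2 hf).differentiable (by norm_num) (x, y))
    (hasFDerivAt_inr x y).differentiableAt).hasFDerivAt

lemma hasFDerivAt_grad1 (x : E m) (y : E n) :
    HasFDerivAt (fun p : E m × E n => grad1 f p.1 p.2)
      ((hess11 f x y).coprod (hess12 f x y)) (x, y) := by
  have h := ((contDiff_grad1 hf).differentiable (by norm_num) (x, y)).hasFDerivAt
  have h1 : HasFDerivAt (fun u => grad1 f u y) _ x := h.comp (f := fun u => (u, y)) x
    (hasFDerivAt_inl x y)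
  have h2 : HasFDerivAt (fun v => grad1 f x v) _ y := h.comp (f := fun v => (x, v)) y
    (hasFDerivAt_inr x y)
  refine h.congr_fderiv ?_
  rw [(hasFDerivAt_grad1_fst hf x y).unique h1, (hasFDerivAt_grad1_snd hf x y).unique h2]
  exact (ContinuousLinearMap.coprod_comp_inl_inr _).symm

lemma hasFDerivAt_grad2 (x : E m) (y : E n) :
    HasFDerivAt (fun p : E m × E n => grad2 f p.1 p.2)
      ((hess21 f x y).coprod (hess22 f x y)) (x, y) := by
  have h := ((contDiff_grad2 hf).differentiable (by norm_num) (x, y)).hasFDerivAt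
  have h1 : HasFDerivAt (fun u => grad2 f u y) _ x := h.comp (f := fun u => (u, y)) x
    (hasFDerivAt_inl x y)
  have h2 : HasFDerivAt (fun v => grad2 f x v) _ y := h.comp (f := fun v => (x, v)) y
    (hasFDerivAt_inr x y)
  refine h.congr_fderiv ?_
  rw [(hasFDerivAt_grad2_fst hf x y).unique h1, (hasFDerivAt_grad2_snd hf x y).unique h2]
  exact (ContinuousLinearMap.coprod_comp_inl_inr _).symm

/-- Identifying the blocks with parts of the second derivative of the joint function lets Schwarz's
theorem supply all symmetries: of the diagonal blocks, and of the off-diagonal pair as mutual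
adjoints. -/
lemma inner_hess_fst (x : E m) (y : E n) (q : E m × E n) (u : E m) :
    inner ℝ (hess11 f x y q.1 + hess12 f x y q.2) u =
      fderiv ℝ (fderiv ℝ (fun p : E m × E n => f p.1 p.2)) (x, y) q (u, 0) := by
  have h1 := (hasFDerivAt_grad1 hf x y).inner ℝ (hasFDerivAt_const u (x, y))
  have h2 := (hasFDerivAt_fderiv_uncurry hf (x, y)).clm_apply
    (hasFDerivAt_const ((u, 0) : E m × E n) (x, y))
  have h3 := DFunLike.congr_fun (h1.unique (h2.congr_of_eventuallyEq
    (Eventually.of_forall fun p => inner_grad1 hf p u))) q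
  simpa [fderivInnerCLM_apply] using h3

lemma inner_hess_snd (x : E m) (y : E n) (q : E m × E n) (v : E n) :
    inner ℝ (hess21 f x y q.1 + hess22 f x y q.2) v =
      fderiv ℝ (fderiv ℝ (fun p : E m × E n => f p.1 p.2)) (x, y) q (0, v) := by
  have h1 := (hasFDerivAt_grad2 hf x y).inner ℝ (hasFDerivAt_const v (x, y))
  have h2 := (hasFDerivAt_fderiv_uncurry hf (x, y)).clm_apply
    (hasFDerivAt_const ((0, v) : E m × E n) (x, y))
  have h3 := DFunLike.congr_fun (h1.unique (h2.congr_of_eventuallyEq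
    (Eventually.of_forall fun p => inner_grad2 hf p v))) q
  simpa [fderivInnerCLM_apply] using h3

lemma isSymm_fderiv_fderiv (p q q' : E m × E n) :
    fderiv ℝ (fderiv ℝ (fun p : E m × E n => f p.1 p.2)) p q q' =
      fderiv ℝ (fderiv ℝ (fun p : E m × E n => f p.1 p.2)) p q' q :=
  hf.contDiffAt.isSymmSndFDerivAt (by simp) q q'

lemma hess11_isSymmetric (x : E m) (y : E n) :
    (hess11 f x y : E m →ₗ[ℝ] E m).IsSymmetric := by
  intro u u'
  have h1 := inner_hess_fst hf x y (u, 0) u'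
  have h2 := inner_hess_fst hf x y (u', 0) u
  simp only [map_zero, add_zero] at h1 h2
  rw [ContinuousLinearMap.coe_coe, h1, isSymm_fderiv_fderiv hf, ← h2, real_inner_comm]

lemma hess22_isSymmetric (x : E m) (y : E n) :
    (hess22 f x y : E n →ₗ[ℝ] E n).IsSymmetric := by
  intro v v'
  have h1 := inner_hess_snd hf x y (0, v) v'
  have h2 := inner_hess_snd hf x y (0, v') v
  simp only [map_zero, zero_add] at h1 h2
  rw [ContinuousLinearMap.coe_coe, h1, isSymm_fderiv_fderiv hf, ← h2, real_inner_comm]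

lemma inner_hess12 (x : E m) (y : E n) (v : E n) (u : E m) :
    inner ℝ (hess12 f x y v) u = inner ℝ v (hess21 f x y u) := by
  have h1 := inner_hess_fst hf x y (0, v) u
  have h2 := inner_hess_snd hf x y (u, 0) v
  simp only [map_zero, zero_add, add_zero] at h1 h2
  rw [h1, isSymm_fderiv_fderiv hf, ← h2, real_inner_comm]

end Regular

/-! ### Bounds on the blocks and Lipschitz continuity of the Schur complement. -/

namespace Assumptions

variable {L₁ L₂ μ : ℝ} (h : Assumptions f L₁ L₂ μ)

include h

lemma norm_grad1_sub_le (x : E m) (y : E n) (x' : E m) (y' : E n) :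
    ‖grad1 f x y - grad1 f x' y'‖ ≤ L₁ * pairDist x y x' y' :=
  (Real.le_sqrt_of_sq_le (by nlinarith [sq_nonneg ‖grad2 f x y - grad2 f x' y'‖])).trans
    (h.smooth x y x' y')

lemma norm_grad2_sub_le (x : E m) (y : E n) (x' : E m) (y' : E n) :
    ‖grad2 f x y - grad2 f x' y'‖ ≤ L₁ * pairDist x y x' y' :=
  (Real.le_sqrt_of_sq_le (by nlinarith [sq_nonneg ‖grad1 f x y - grad1 f x' y'‖])).trans
    (h.smooth x y x' y')

lemma norm_hess12_le (hL : 0 ≤ L₁) (x : E m) (y : E n) : ‖hess12 f x y‖ ≤ L₁ :=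
  norm_fderiv_le_of_lip' ℝ hL (Eventually.of_forall fun v => by
    simpa using h.norm_grad1_sub_le x v x y)

lemma norm_hess21_le (hL : 0 ≤ L₁) (x : E m) (y : E n) : ‖hess21 f x y‖ ≤ L₁ :=
  norm_fderiv_le_of_lip' ℝ hL (Eventually.of_forall fun v => by
    simpa using h.norm_grad2_sub_le v y x y)

lemma norm_hess22_le (hL : 0 ≤ L₁) (x : E m) (y : E n) : ‖hess22 f x y‖ ≤ L₁ :=
  norm_fderiv_le_of_lip' ℝ hL (Eventually.of_forall fun v => by
    simpa using h.norm_grad2_sub_le x v x y)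

lemma inner_hess22_le (x : E m) (y v : E n) :
    inner ℝ (hess22 f x y v) v ≤ -μ * ‖v‖ ^ 2 :=
  StrongConcaveOn.inner_fderiv_le (h.strongConcave x) (fun y => hasFDerivAt_snd h.contDiff x y)
    (hasFDerivAt_grad2_snd h.contDiff x y) v

lemma le_inner_hess22 (hL : 0 ≤ L₁) (x : E m) (y v : E n) :
    -L₁ * ‖v‖ ^ 2 ≤ inner ℝ (hess22 f x y v) v := by
  have h1 := abs_le.1 ((abs_real_inner_le_norm (hess22 f x y v) v).trans
    (mul_le_mul_of_nonneg_right ((hess22 f x y).le_of_opNorm_le (h.norm_hess22_le hL x y) v)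
      (norm_nonneg v)))
  nlinarith [h1.1]

lemma mu_le (hL : 0 ≤ L₁) (hn : 0 < n) : μ ≤ L₁ := by
  have : NeZero n := ⟨hn.ne'⟩
  have h1 := h.inner_hess22_le 0 0 (EuclideanSpace.single (0 : Fin n) 1)
  have h2 := h.le_inner_hess22 hL 0 0 (EuclideanSpace.single (0 : Fin n) 1)
  simp at h1 h2
  linarith

lemma mul_norm_le_norm_hess22 (x : E m) (y v : E n) : μ * ‖v‖ ≤ ‖hess22 f x y v‖ := by
  rcases (norm_nonneg v).eq_or_lt with hv | hv
  · simp [← hv]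
  have h1 := h.inner_hess22_le x y v
  have h2 := (abs_le.1 (abs_real_inner_le_norm (hess22 f x y v) v)).1
  refine le_of_mul_le_mul_right ?_ hv
  nlinarith

/-- The lower bound `μ` gives injectivity, which suffices in finite dimension. This is what makes
`inverse` a genuine inverse rather than its default value zero. -/
lemma hess22_isInvertible (hμ : 0 < μ) (x : E m) (y : E n) : (hess22 f x y).IsInvertible := by
  have hinj : Function.Injective (hess22 f x y : E n →ₗ[ℝ] E n) := by
    rw [injective_iff_map_eq_zero]
    intro v hv
    have := h.mul_norm_le_norm_hess22 x y v
    rw [ContinuousLinearMap.coe_coe] at hv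
    rw [hv, norm_zero] at this
    exact norm_le_zero_iff.1 (nonpos_of_mul_nonpos_right this hμ)
  exact ⟨(LinearEquiv.ofInjectiveEndo _ hinj).toContinuousLinearEquiv, by ext v; rfl⟩

lemma hess22_inverse_apply (hμ : 0 < μ) (x : E m) (y v : E n) :
    hess22 f x y ((hess22 f x y).inverse v) = v :=
  (h.hess22_isInvertible hμ x y).self_apply_inverse v

lemma hess22_inverse_apply_self (hμ : 0 < μ) (x : E m) (y v : E n) :
    (hess22 f x y).inverse (hess22 f x y v) = v :=
  (h.hess22_isInvertible hμ x y).inverse_apply_self v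

lemma norm_hess22_inverse_le (hμ : 0 < μ) (x : E m) (y : E n) :
    ‖(hess22 f x y).inverse‖ ≤ 1 / μ := by
  refine ContinuousLinearMap.opNorm_le_bound _ (by positivity) fun v => ?_
  have := h.mul_norm_le_norm_hess22 x y ((hess22 f x y).inverse v)
  rw [h.hess22_inverse_apply hμ] at this
  rw [one_div, inv_mul_eq_div, le_div_iff₀ hμ]
  linarith

lemma norm_hess22_inverse_sub_le (hμ : 0 < μ) (x : E m) (y : E n) (x' : E m) (y' : E n) :
    ‖(hess22 f x y).inverse - (hess22 f x' y').inverse‖ ≤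
      1 / μ * (L₂ * pairDist x y x' y' * (1 / μ)) := by
  -- Resolvent identity `A⁻¹ - B⁻¹ = -A⁻¹(A - B)B⁻¹`.
  have he : (hess22 f x y).inverse - (hess22 f x' y').inverse =
      -((hess22 f x y).inverse.comp
        ((hess22 f x y - hess22 f x' y').comp (hess22 f x' y').inverse)) := by
    ext1 v
    simp [h.hess22_inverse_apply hμ, h.hess22_inverse_apply_self hμ]
  rw [he, norm_neg]
  refine (ContinuousLinearMap.opNorm_comp_le _ _).trans ?_
  refine mul_le_mul (h.norm_hess22_inverse_le hμ x y) ?_ (norm_nonneg _) (by positivity)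
  refine (ContinuousLinearMap.opNorm_comp_le _ _).trans ?_
  exact mul_le_mul (h.lip22 x y x' y') (h.norm_hess22_inverse_le hμ x' y') (norm_nonneg _)
    ((norm_nonneg _).trans (h.lip22 x y x' y'))

lemma schurG_isSymmetric (hμ : 0 < μ) (x : E m) (y : E n) :
    (schurG f x y : E m →ₗ[ℝ] E m).IsSymmetric := by
  have hinv : ∀ v v', inner ℝ ((hess22 f x y).inverse v) v' =
      inner ℝ v ((hess22 f x y).inverse v') := by
    intro v v'
    have := hess22_isSymmetric h.contDiff x y ((hess22 f x y).inverse v)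
      ((hess22 f x y).inverse v')
    simp only [ContinuousLinearMap.coe_coe, h.hess22_inverse_apply hμ] at this
    exact this.symm
  intro u u'
  have h1 := hess11_isSymmetric h.contDiff x y u u'
  simp only [ContinuousLinearMap.coe_coe] at h1
  simp only [schurG, ContinuousLinearMap.coe_coe, sub_apply, ContinuousLinearMap.comp_apply,
    inner_sub_left, inner_sub_right, h1]
  rw [inner_hess12 h.contDiff, hinv, ← real_inner_comm u (hess12 f x y _),
    inner_hess12 h.contDiff, real_inner_comm ((hess22 f x y).inverse _)]

lemma norm_schurG_sub_le (hL : 0 < L₁) (hμ : 0 < μ) (x : E m) (y : E n) (x' : E m) (y' : E n) :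
    ‖schurG f x y - schurG f x' y'‖ ≤ LG L₁ L₂ μ * pairDist x y x' y' := by
  set d := pairDist x y x' y'
  set B := hess12 f x y
  set B' := hess12 f x' y'
  set I := (hess22 f x y).inverse with hI
  set I' := (hess22 f x' y').inverse with hI'
  set C := hess21 f x y
  set C' := hess21 f x' y'
  -- Changing one factor at a time, the four differences contribute `1`, `κ`, `κ²` and `κ` times `L₂
  -- * d`, which add up to `(1 + κ)²`.
  have he : schurG f x y - schurG f x' y' = (hess11 f x y - hess11 f x' y')
      - ((B - B').comp (I.comp C) + B'.comp ((I - I').comp C) + B'.comp (I'.comp (C - C'))) := by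
    ext1 v
    simp only [schurG, sub_apply, add_apply, ContinuousLinearMap.comp_apply, map_sub]
    abel
  have hc : ∀ {a b : ℝ} {k l : ℕ} {X : E k →L[ℝ] E l} {Y : E m →L[ℝ] E k}, ‖X‖ ≤ a → ‖Y‖ ≤ b →
      ‖X.comp Y‖ ≤ a * b := fun hX hY => (ContinuousLinearMap.opNorm_comp_le _ _).trans
    (mul_le_mul hX hY (norm_nonneg _) ((norm_nonneg _).trans hX))
  have h1 : ‖(B - B').comp (I.comp C)‖ ≤ L₂ * d * (1 / μ * L₁) :=
    hc (h.lip12 x y x' y') (hc (h.norm_hess22_inverse_le hμ x y) (h.norm_hess21_le hL.le x y))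
  have h2 : ‖B'.comp ((I - I').comp C)‖ ≤ L₁ * (1 / μ * (L₂ * d * (1 / μ)) * L₁) :=
    hc (h.norm_hess12_le hL.le x' y') (hc (h.norm_hess22_inverse_sub_le hμ x y x' y')
      (h.norm_hess21_le hL.le x y))
  have h3 : ‖B'.comp (I'.comp (C - C'))‖ ≤ L₁ * (1 / μ * (L₂ * d)) :=
    hc (h.norm_hess12_le hL.le x' y') (hc (h.norm_hess22_inverse_le hμ x' y')
      (h.lip21 x y x' y'))
  have h4 : ‖hess11 f x y - hess11 f x' y'‖ ≤ L₂ * d := h.lip11 x y x' y'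
  rw [he]
  refine (norm_sub_le _ _).trans ((add_le_add h4 (norm_add₃_le.trans
    (add_le_add (add_le_add h1 h2) h3))).trans (le_of_eq ?_))
  rw [LG]
  field_simp
  ring

end Assumptions

end Calculus

/-! ### The inner maximization, and the gradient and Hessian of the envelope. -/

section Envelope

variable {m n : ℕ} {f : E m → E n → ℝ}

namespace Assumptions

variable {L₁ L₂ μ : ℝ} (h : Assumptions f L₁ L₂ μ)

include h

lemma hasFDerivAt_ascentStep (η : ℝ) (x : E m) (y : E n) :
    HasFDerivAt (ascentStep f η x) (ContinuousLinearMap.id ℝ (E n) + η • hess22 f x y) y :=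
  (hasFDerivAt_id y).add ((hasFDerivAt_grad2_snd h.contDiff x y).const_smul η)

/-- The derivative of the step is symmetric, and the spectrum of `hess22` lies in `[-L₁, -μ]`. The
step size `2 / (L₁ + μ)` sends the two ends of this interval to opposite numbers of modulus `(L₁ -
μ) / (L₁ + μ)`. -/
lemma norm_ascentStep_sub_le (hL : 0 < L₁) (hμ : 0 < μ) (hn : 0 < n) (x : E m) (y y' : E n) :
    ‖ascentStep f (2 / (L₁ + μ)) x y - ascentStep f (2 / (L₁ + μ)) x y'‖ ≤
      (L₁ - μ) / (L₁ + μ) * ‖y - y'‖ := by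
  have hμL := h.mu_le hL.le hn
  have hs : 0 < L₁ + μ := by positivity
  have hρ : 0 ≤ (L₁ - μ) / (L₁ + μ) := div_nonneg (sub_nonneg.2 hμL) hs.le
  refine convex_univ.norm_image_sub_le_of_norm_hasFDerivWithin_le (𝕜 := ℝ)
    (fun y _ => (h.hasFDerivAt_ascentStep (2 / (L₁ + μ)) x y).hasFDerivWithinAt) (fun y _ => ?_)
    (Set.mem_univ y') (Set.mem_univ y)
  refine norm_le_of_abs_inner_self_le (fun v v' => ?_) hρ fun v => ?_
  · have := hess22_isSymmetric h.contDiff x y v v'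
    simp only [ContinuousLinearMap.coe_coe] at this
    simp [inner_add_left, inner_add_right, inner_smul_left, inner_smul_right, this]
  · have h1 := h.inner_hess22_le x y v
    have h2 := h.le_inner_hess22 hL.le x y v
    have he : inner ℝ ((ContinuousLinearMap.id ℝ (E n) + (2 / (L₁ + μ)) • hess22 f x y) v) v
        = ‖v‖ ^ 2 + 2 / (L₁ + μ) * inner ℝ (hess22 f x y v) v := by
      simp [inner_add_left, inner_smul_left]
    have h3 := mul_le_mul_of_nonneg_left h1 (by positivity : 0 ≤ 2 / (L₁ + μ))
    have h4 := mul_le_mul_of_nonneg_left h2 (by positivity : 0 ≤ 2 / (L₁ + μ))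
    have e1 : 2 / (L₁ + μ) * (-μ * ‖v‖ ^ 2) = (L₁ - μ) / (L₁ + μ) * ‖v‖ ^ 2 - ‖v‖ ^ 2 := by
      field_simp; ring
    have e2 : 2 / (L₁ + μ) * (-L₁ * ‖v‖ ^ 2) = -((L₁ - μ) / (L₁ + μ) * ‖v‖ ^ 2) - ‖v‖ ^ 2 := by
      field_simp; ring
    rw [he, abs_le]
    constructor <;> linarith

lemma isMaxOn_of_grad2_eq_zero (hμ : 0 < μ) {x : E m} {y : E n} (hy : grad2 f x y = 0) :
    IsMaxOn (fun v => f x v) Set.univ y := by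
  intro v _
  have := StrongConcaveOn.le_add_inner (h.strongConcave x) (hasFDerivAt_snd h.contDiff x y) v
  rw [hy, inner_zero_left] at this
  have h2 : 0 ≤ μ / 2 * ‖v - y‖ ^ 2 := by positivity
  change f x v ≤ f x y
  linarith

/-- The ascent step is a contraction, and its Banach fixed point is a critical point, hence a
maximizer. Existence is needed because `yStar` is defined by choice. -/
lemma exists_grad2_eq_zero (hL : 0 < L₁) (hμ : 0 < μ) (hn : 0 < n) (x : E m) :
    ∃ y, grad2 f x y = 0 := by
  have hμL := h.mu_le hL.le hn
  have hs : 0 < L₁ + μ := by positivity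
  have hρ : 0 ≤ (L₁ - μ) / (L₁ + μ) := div_nonneg (sub_nonneg.2 hμL) hs.le
  have hc : ContractingWith ⟨(L₁ - μ) / (L₁ + μ), hρ⟩ (ascentStep f (2 / (L₁ + μ)) x) := by
    refine ⟨?_, LipschitzWith.of_dist_le_mul fun y y' => ?_⟩
    · change (L₁ - μ) / (L₁ + μ) < 1
      rw [div_lt_one hs]
      linarith
    · rw [dist_eq_norm, dist_eq_norm]
      exact h.norm_ascentStep_sub_le hL hμ hn x y y'
  refine ⟨hc.fixedPoint, ?_⟩
  have hfix : ascentStep f (2 / (L₁ + μ)) x hc.fixedPoint = hc.fixedPoint :=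
    hc.fixedPoint_isFixedPt
  rw [ascentStep, add_eq_left, smul_eq_zero] at hfix
  exact hfix.resolve_left (by positivity)

lemma isMaxOn_yStar (hL : 0 < L₁) (hμ : 0 < μ) (hn : 0 < n) (x : E m) :
    IsMaxOn (fun v => f x v) Set.univ (yStar f x) := by
  obtain ⟨y, hy⟩ := h.exists_grad2_eq_zero hL hμ hn x
  exact Classical.epsilon_spec ⟨y, h.isMaxOn_of_grad2_eq_zero hμ hy⟩

lemma grad2_yStar (hL : 0 < L₁) (hμ : 0 < μ) (hn : 0 < n) (x : E m) :
    grad2 f x (yStar f x) = 0 := by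
  have := ((h.isMaxOn_yStar hL hμ hn x).isLocalMax univ_mem).hasFDerivAt_eq_zero
    (hasFDerivAt_snd h.contDiff x (yStar f x))
  exact inner_self_eq_zero.1 (DFunLike.congr_fun this (grad2 f x (yStar f x)))

lemma envelope_eq (hL : 0 < L₁) (hμ : 0 < μ) (hn : 0 < n) (x : E m) :
    envelope f x = f x (yStar f x) := by
  have hmax := h.isMaxOn_yStar hL hμ hn x
  refine le_antisymm (ciSup_le fun y => hmax (Set.mem_univ y)) ?_
  exact le_ciSup (f := fun y => f x y)
    ⟨f x (yStar f x), by rintro _ ⟨y, rfl⟩; exact hmax (Set.mem_univ y)⟩ (yStar f x)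

lemma norm_iterate_ascentStep_sub_le (hL : 0 < L₁) (hμ : 0 < μ) (hn : 0 < n) (x : E m) (y : E n)
    (k : ℕ) : ‖(ascentStep f (2 / (L₁ + μ)) x)^[k] y - yStar f x‖ ≤
      ((L₁ - μ) / (L₁ + μ)) ^ k * ‖y - yStar f x‖ := by
  have hμL := h.mu_le hL.le hn
  have hρ : 0 ≤ (L₁ - μ) / (L₁ + μ) := div_nonneg (sub_nonneg.2 hμL) (by positivity)
  induction k with
  | zero => simp
  | succ k ih =>
    have hfix : ascentStep f (2 / (L₁ + μ)) x (yStar f x) = yStar f x := by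
      simp [ascentStep, h.grad2_yStar hL hμ hn]
    rw [Function.iterate_succ_apply']
    conv_lhs => rw [← hfix]
    refine (h.norm_ascentStep_sub_le hL hμ hn x _ _).trans ?_
    rw [pow_succ', mul_assoc]
    exact mul_le_mul_of_nonneg_left ih hρ

/-- Exponential contraction of the inner gradient ascent loop. -/
lemma norm_iterate_ascentStep_sub_le_exp (hL : 0 < L₁) (hμ : 0 < μ) (hn : 0 < n) (x : E m)
    (y : E n) (k : ℕ) : ‖(ascentStep f (2 / (L₁ + μ)) x)^[k] y - yStar f x‖ ≤
      Real.exp (-(k / (L₁ / μ))) * ‖y - yStar f x‖ := by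
  have hμL := h.mu_le hL.le hn
  have hρ : 0 ≤ (L₁ - μ) / (L₁ + μ) := div_nonneg (sub_nonneg.2 hμL) (by positivity)
  refine (h.norm_iterate_ascentStep_sub_le hL hμ hn x y k).trans
    (mul_le_mul_of_nonneg_right ?_ (norm_nonneg _))
  -- The intermediate bound is `1 - μ / L₁`, valid because `μ ≤ L₁`.
  have h1 : (L₁ - μ) / (L₁ + μ) ≤ Real.exp (-(μ / L₁)) := by
    refine le_trans ?_ (Real.add_one_le_exp _)
    rw [div_le_iff₀ (by positivity)]
    have : (-(μ / L₁) + 1) * (L₁ + μ) = L₁ - μ ^ 2 / L₁ := by field_simp; ring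
    rw [this]
    have : μ ^ 2 / L₁ ≤ μ := by rw [div_le_iff₀ hL]; nlinarith
    linarith
  refine (pow_le_pow_left₀ hρ h1 k).trans (le_of_eq ?_)
  rw [← Real.exp_nat_mul]
  congr 1
  field_simp

/-- Strong monotonicity of `grad2 f x` between the two maximizers bounds `μ` times their distance by
`‖grad2 f x (yStar f x')‖`. Since the gradient at `(x', yStar f x')` vanishes, that norm is at most
`L₁ * ‖x - x'‖`. -/
lemma norm_yStar_sub_le (hL : 0 < L₁) (hμ : 0 < μ) (hn : 0 < n) (x x' : E m) :
    ‖yStar f x - yStar f x'‖ ≤ L₁ / μ * ‖x - x'‖ := by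
  rcases (norm_nonneg (yStar f x - yStar f x')).eq_or_lt with hv | hv
  · rw [← hv]; positivity
  have h1 := StrongConcaveOn.inner_sub_le (h.strongConcave x)
    (fun y => hasFDerivAt_snd h.contDiff x y) (yStar f x') (yStar f x)
  have h2 := h.norm_grad2_sub_le x (yStar f x') x' (yStar f x')
  rw [h.grad2_yStar hL hμ hn, zero_sub, inner_neg_left] at h1
  rw [h.grad2_yStar hL hμ hn, sub_zero, pairDist_same_snd] at h2
  have h3 := real_inner_le_norm (grad2 f x (yStar f x')) (yStar f x - yStar f x')
  have h4 := h3.trans (mul_le_mul_of_nonneg_right h2 hv.le)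
  rw [div_mul_eq_mul_div, le_div_iff₀ hμ]
  refine le_of_mul_le_mul_right ?_ hv
  linarith

lemma tendsto_yStar (hL : 0 < L₁) (hμ : 0 < μ) (hn : 0 < n) (x : E m) :
    Tendsto (yStar f) (𝓝 x) (𝓝 (yStar f x)) := by
  refine (LipschitzWith.of_dist_le_mul (K := ⟨L₁ / μ, by positivity⟩)
    fun x x' => ?_).continuous.tendsto x
  rw [dist_eq_norm, dist_eq_norm]
  exact h.norm_yStar_sub_le hL hμ hn x x'

/-- Along the graph of `yStar` the gradient `grad2 f` vanishes identically, so its first-order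
expansion is pure remainder. The Lipschitz bound makes that remainder `o(x' - x)`, and applying the
inverse of `hess22` solves for the increment of `yStar`. -/
lemma hasFDerivAt_yStar (hL : 0 < L₁) (hμ : 0 < μ) (hn : 0 < n) (x : E m) :
    HasFDerivAt (yStar f) (-((hess22 f x (yStar f x)).inverse.comp (hess21 f x (yStar f x)))) x := by
  have hd := (hasFDerivAt_grad2 h.contDiff x (yStar f x)).isLittleO
  have ht : Tendsto (fun x' => (x', yStar f x')) (𝓝 x) (𝓝 (x, yStar f x)) :=
    tendsto_id.prodMk_nhds (h.tendsto_yStar hL hμ hn x)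
  have h1 := hd.comp_tendsto ht
  have hO : (fun x' => (x', yStar f x') - (x, yStar f x)) =O[𝓝 x] fun x' => x' - x := by
    refine (Asymptotics.isBigO_refl _ _).prod_left ?_
    exact Asymptotics.IsBigO.of_bound (L₁ / μ)
      (Eventually.of_forall fun x' => h.norm_yStar_sub_le hL hμ hn x' x)
  have h2 := h1.trans_isBigO hO
  have h3 := ((hess22 f x (yStar f x)).inverse.isBigO_comp _ _).trans_isLittleO h2
  refine HasFDerivAt.of_isLittleO (h3.neg_left.congr_left fun x' => ?_)
  simp only [Function.comp_apply, h.grad2_yStar hL hμ hn, ContinuousLinearMap.coprod_apply,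
    map_sub, map_add, sub_zero, map_zero, h.hess22_inverse_apply_self hμ,
    neg_apply, ContinuousLinearMap.comp_apply]
  abel

lemma hasFDerivAt_graph_yStar (hL : 0 < L₁) (hμ : 0 < μ) (hn : 0 < n) (x : E m) :
    HasFDerivAt (fun x => (x, yStar f x)) ((ContinuousLinearMap.id ℝ (E m)).prod
      (-((hess22 f x (yStar f x)).inverse.comp (hess21 f x (yStar f x))))) x :=
  (hasFDerivAt_id x).prodMk (h.hasFDerivAt_yStar hL hμ hn x)

lemma hasFDerivAt_envelope (hL : 0 < L₁) (hμ : 0 < μ) (hn : 0 < n) (x : E m) :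
    HasFDerivAt (envelope f) (innerSL ℝ (grad1 f x (yStar f x))) x := by
  have h1 := (hasFDerivAt_uncurry h.contDiff (x, yStar f x)).comp x
    (h.hasFDerivAt_graph_yStar hL hμ hn x)
  rw [show envelope f = fun x => f x (yStar f x) from funext (h.envelope_eq hL hμ hn)]
  refine HasFDerivAt.congr_fderiv (f := fun x => f x (yStar f x)) h1 ?_
  ext u
  have e1 := inner_grad1 h.contDiff (x, yStar f x) u
  have e2 := inner_grad2 h.contDiff (x, yStar f x)
    -- Danskin's argument: the contribution through the movement of `yStar` is paired with `grad2`,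
    -- which vanishes at the maximizer.
    (-((hess22 f x (yStar f x)).inverse (hess21 f x (yStar f x) u)))
  simp only [h.grad2_yStar hL hμ hn, inner_zero_left] at e2
  simp only [innerSL_apply_apply, ContinuousLinearMap.comp_apply, ContinuousLinearMap.prod_apply,
    ContinuousLinearMap.id_apply, neg_apply]
  rw [e1, ← add_zero (fderiv ℝ _ _ (u, 0)), e2, ← map_add]
  simp

lemma gradient_envelope (hL : 0 < L₁) (hμ : 0 < μ) (hn : 0 < n) :
    gradient (envelope f) = fun x => grad1 f x (yStar f x) :=
  gradient_eq fun x => h.hasFDerivAt_envelope hL hμ hn x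

lemma hasFDerivAt_gradient_envelope (hL : 0 < L₁) (hμ : 0 < μ) (hn : 0 < n) (x : E m) :
    HasFDerivAt (fun x => grad1 f x (yStar f x)) (schurG f x (yStar f x)) x := by
  have h1 := (hasFDerivAt_grad1 h.contDiff x (yStar f x)).comp x
    (h.hasFDerivAt_graph_yStar hL hμ hn x)
  refine HasFDerivAt.congr_fderiv (f := fun x => grad1 f x (yStar f x)) h1 ?_
  ext1 u
  simp [schurG, sub_eq_add_neg]

lemma hessian_envelope (hL : 0 < L₁) (hμ : 0 < μ) (hn : 0 < n) (x : E m) :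
    hessian (envelope f) x = schurG f x (yStar f x) := by
  rw [hessian, h.gradient_envelope hL hμ hn]
  exact (h.hasFDerivAt_gradient_envelope hL hμ hn x).fderiv

lemma norm_schurG_yStar_sub_le (hL : 0 < L₁) (hL₂ : 0 < L₂) (hμ : 0 < μ) (hn : 0 < n)
    (x x' : E m) :
    ‖schurG f x (yStar f x) - schurG f x' (yStar f x')‖ ≤ LPhi L₁ L₂ μ * ‖x - x'‖ := by
  refine (h.norm_schurG_sub_le hL hμ _ _ _ _).trans ?_
  have h1 : pairDist x (yStar f x) x' (yStar f x') ≤ (1 + L₁ / μ) * ‖x - x'‖ := by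
    refine Real.sqrt_le_iff.2 ⟨by positivity, ?_⟩
    have h2 := pow_le_pow_left₀ (norm_nonneg _) (h.norm_yStar_sub_le hL hμ hn x x') 2
    have h3 : 0 ≤ L₁ / μ * ‖x - x'‖ ^ 2 := by positivity
    nlinarith
  have hLG : 0 ≤ LG L₁ L₂ μ := by unfold LG; positivity
  refine (mul_le_mul_of_nonneg_left h1 hLG).trans (le_of_eq ?_)
  simp only [LG, LPhi]
  ring

end Assumptions

end Envelope

/-! ### Summation of the descent inequality. -/

/-- A cubic descent recursion whose steps are not small twice in a row controls the sum of cubes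
of the steps. -/
lemma sum_cubes_le_of_descent {φ r : ℕ → ℝ} {L e : ℝ} {K : ℕ} (hL : 0 < L) (he : 0 < e)
    (hr : ∀ t, 0 ≤ r t) (hr0 : r 0 = e)
    (hdesc : ∀ t < K, φ (t + 1) ≤ φ t + L * (-(49 / 4) * r (t + 1) ^ 3
      + 5 / 6 * (r t ^ 3 + e ^ 3)))
    (hmax : ∀ t < K, e < max (r t) (r (t + 1))) :
    K * e ^ 3 ≤ 2 * ∑ t ∈ Finset.range K, r (t + 1) ^ 3 ∧
      8 * L * ∑ t ∈ Finset.range K, r (t + 1) ^ 3 ≤ φ 0 - φ K := by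
  have hr3 : ∀ t, 0 ≤ r t ^ 3 := fun t => pow_nonneg (hr t) 3
  have he3 : 0 < e ^ 3 := by positivity
  -- The convention `r 0 = e` forces the first true step to be large, which starts the count for odd
  -- `K`.
  have hfirst : 0 < K → e ^ 3 ≤ r 1 ^ 3 := fun hK => by
    rcases lt_max_iff.1 (hmax 0 hK) with h | h
    · exact absurd hr0 h.ne'
    · exact pow_le_pow_left₀ he.le h.le 3
  have hpair : ∀ t < K, e ^ 3 ≤ r t ^ 3 + r (t + 1) ^ 3 := fun t ht => by
    rcases lt_max_iff.1 (hmax t ht) with h | h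
    · linarith [pow_le_pow_left₀ he.le h.le 3, hr3 (t + 1)]
    · linarith [pow_le_pow_left₀ he.le h.le 3, hr3 t]
  have hcount : ∀ k, k ≤ K → k * e ^ 3 ≤ 2 * ∑ t ∈ Finset.range k, r (t + 1) ^ 3 := by
    intro k
    induction k using Nat.twoStepInduction with
    | zero => simp
    | one =>
      intro hK
      have := hfirst hK
      simp
      linarith
    | more k ih _ =>
      intro hk
      have h1 := ih (by omega)
      have h2 := hpair (k + 1) (by omega)
      rw [Finset.sum_range_succ, Finset.sum_range_succ]
      push_cast
      linarith
  refine ⟨hcount K le_rfl, ?_⟩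
  have htele : ∀ k, k ≤ K → φ k ≤ φ 0 + L * (-(49 / 4) * ∑ t ∈ Finset.range k, r (t + 1) ^ 3
      + 5 / 6 * (∑ t ∈ Finset.range k, r t ^ 3 + k * e ^ 3)) := by
    intro k
    induction k with
    | zero => simp
    | succ k ih =>
      intro hk
      have h1 := ih (by omega)
      have h2 := hdesc k (by omega)
      rw [Finset.sum_range_succ, Finset.sum_range_succ]
      push_cast
      linarith
  rcases Nat.eq_zero_or_pos K with rfl | hK
  · simp
  have h1 := htele K le_rfl
  have h2 := hcount K le_rfl
  have h3 : ∑ t ∈ Finset.range K, r t ^ 3 ≤ e ^ 3 + ∑ t ∈ Finset.range K, r (t + 1) ^ 3 := by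
    have := Finset.sum_range_succ (fun t => r t ^ 3) K
    rw [Finset.sum_range_succ', hr0] at this
    linarith [hr3 K]
  have h4 : e ^ 3 ≤ ∑ t ∈ Finset.range K, r (t + 1) ^ 3 :=
    (hfirst hK).trans (Finset.single_le_sum (f := fun t => r (t + 1) ^ 3)
      (fun t _ => hr3 _) (Finset.mem_range.2 hK))
  set S := ∑ t ∈ Finset.range K, r (t + 1) ^ 3
  -- The shifted sum and `K * e ^ 3` are each at most `2 * S`, so the errors cost `10 / 3 * S`, and
  -- `49 / 4 - 10 / 3 > 8`.
  have h5 : -(49 / 4) * S + 5 / 6 * (∑ t ∈ Finset.range K, r t ^ 3 + K * e ^ 3) ≤ -8 * S := by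
    linarith
  have h6 := mul_le_mul_of_nonneg_left h5 hL.le
  linarith

lemma exp_neg_div_le_inv {κ A N : ℝ} (hκ : 0 < κ) (hA : 0 < A) (hN : κ * Real.log A ≤ N) :
    Real.exp (-(N / κ)) ≤ A⁻¹ := by
  rw [Real.exp_neg]
  refine inv_anti₀ hA ?_
  rw [← Real.log_le_iff_le_exp hA, le_div_iff₀ hκ]
  linarith

/-! ### One cubic step with inexact gradient and Hessian. -/

section OneStep

variable {m n : ℕ} {f : E m → E n → ℝ} {L₁ L₂ μ : ℝ}

lemma LG_pos (hL : 0 < L₁) (hL₂ : 0 < L₂) (hμ : 0 < μ) : 0 < LG L₁ L₂ μ := by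
  unfold LG; positivity

lemma LPhi_pos (hL : 0 < L₁) (hL₂ : 0 < L₂) (hμ : 0 < μ) : 0 < LPhi L₁ L₂ μ := by
  unfold LPhi; positivity

variable (h : Assumptions f L₁ L₂ μ) (hL : 0 < L₁) (hL₂ : 0 < L₂) (hμ : 0 < μ) (hn : 0 < n)
  {ηx a e : ℝ} {x s : E m} {y : E n} (ha : 0 ≤ a) (he : 0 ≤ e)
  (hη₁ : 1 / (56 * LPhi L₁ L₂ μ) ≤ ηx) (hη₂ : ηx ≤ 1 / (55 * LPhi L₁ L₂ μ))
  (hs : IsMinOn (cubicModel f ηx x y) Set.univ s)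
  (hg : L₁ * ‖y - yStar f x‖ ≤ LPhi L₁ L₂ μ * (a ^ 2 + e ^ 2))
  (hG : LG L₁ L₂ μ * ‖y - yStar f x‖ ≤ LPhi L₁ L₂ μ * (a + e))

include hL hL₂ hμ hη₁ hη₂ in
lemma cubic_coeff_bounds : 55 / 2 * LPhi L₁ L₂ μ ≤ 3 * (1 / (6 * ηx)) ∧
    3 * (1 / (6 * ηx)) ≤ 28 * LPhi L₁ L₂ μ := by
  have hΦ := LPhi_pos hL hL₂ hμ
  have hη : 0 < ηx := lt_of_lt_of_le (by positivity) hη₁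
  have e1 : 3 * (1 / (6 * ηx)) = 1 / (2 * ηx) := by field_simp; norm_num
  rw [div_le_iff₀ (by positivity)] at hη₁
  rw [le_div_iff₀ (by positivity)] at hη₂
  rw [e1, le_div_iff₀ (by positivity), div_le_iff₀ (by positivity)]
  constructor <;> linarith

include h hg in
lemma norm_grad1_sub_yStar_le :
    ‖grad1 f x (yStar f x) - grad1 f x y‖ ≤ LPhi L₁ L₂ μ * (a ^ 2 + e ^ 2) := by
  refine (h.norm_grad1_sub_le _ _ _ _).trans ?_
  rwa [pairDist_same_fst, norm_sub_rev]

include h hL hμ hG in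
lemma norm_schurG_sub_yStar_le :
    ‖schurG f x (yStar f x) - schurG f x y‖ ≤ LPhi L₁ L₂ μ * (a + e) := by
  refine (h.norm_schurG_sub_le hL hμ _ _ _ _).trans ?_
  rwa [pairDist_same_fst, norm_sub_rev]

include h hL hL₂ hμ hn ha he hη₁ hη₂ hs hg hG

/-- Sufficient decrease of the envelope in one inexact cubic step. -/
lemma envelope_cubic_step_le : envelope f (x + s) ≤ envelope f x +
    LPhi L₁ L₂ μ * (-(49 / 4) * ‖s‖ ^ 3 + 5 / 6 * (a ^ 3 + e ^ 3)) := by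
  have hΦ := LPhi_pos hL hL₂ hμ
  obtain ⟨hc1, -⟩ := cubic_coeff_bounds hL hL₂ hμ hη₁ hη₂
  have hfo := cubic_first_order (h.schurG_isSymmetric hμ x y) hs
  have hso := cubic_second_order (h.schurG_isSymmetric hμ x y) hs s
  have ht := le_taylor_of_lipschitz_hessian (h.hasFDerivAt_envelope hL hμ hn)
    (h.hasFDerivAt_gradient_envelope hL hμ hn) (h.norm_schurG_yStar_sub_le hL hL₂ hμ hn) x s
  set Λ := LPhi L₁ L₂ μ
  set c := 1 / (6 * ηx)
  have hr : 0 ≤ ‖s‖ := norm_nonneg s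
  have h1 : inner ℝ (grad1 f x y) s + inner ℝ (schurG f x y s) s + 3 * c * ‖s‖ ^ 3 = 0 := by
    have := congrArg (fun v => inner ℝ v s) hfo
    simp only [inner_add_left, inner_smul_left, real_inner_self_eq_norm_sq, inner_zero_left,
      conj_trivial] at this
    linarith
  have h2 : inner ℝ (grad1 f x (yStar f x)) s ≤
      inner ℝ (grad1 f x y) s + Λ * (a ^ 2 + e ^ 2) * ‖s‖ := by
    have := (real_inner_le_norm (grad1 f x (yStar f x) - grad1 f x y) s).trans
      (mul_le_mul_of_nonneg_right (norm_grad1_sub_yStar_le h hg) hr)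
    rw [inner_sub_left] at this
    linarith
  have h3 : inner ℝ (schurG f x (yStar f x) s) s ≤
      inner ℝ (schurG f x y s) s + Λ * (a + e) * ‖s‖ ^ 2 := by
    have := (real_inner_le_norm ((schurG f x (yStar f x) - schurG f x y) s) s).trans
      (mul_le_mul_of_nonneg_right (ContinuousLinearMap.le_of_opNorm_le _
        (norm_schurG_sub_yStar_le h hL hμ hG) s) hr)
    rw [sub_apply, inner_sub_left] at this
    linarith
  have hr3 : 0 ≤ ‖s‖ ^ 3 := by positivity
  have h4 : 55 / 2 * Λ * ‖s‖ ^ 3 ≤ 3 * c * ‖s‖ ^ 3 := mul_le_mul_of_nonneg_right hc1 hr3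
  -- Young's inequality trades the mixed error terms for cubes.
  have young : ∀ u v : ℝ, 0 ≤ u → 0 ≤ v → u ^ 2 * v ≤ 2 / 3 * u ^ 3 + 1 / 3 * v ^ 3 := by
    intro u v hu hv
    nlinarith [mul_nonneg (add_nonneg hu (add_nonneg hu hv)) (sq_nonneg (u - v)),
      mul_nonneg hv (sq_nonneg (u - v)), mul_nonneg hu (sq_nonneg (u - v))]
  have y1 := young a ‖s‖ ha hr
  have y2 := young e ‖s‖ he hr
  have y3 := young ‖s‖ a hr ha
  have y4 := young ‖s‖ e hr he
  have h5 : Λ * (a ^ 2 + e ^ 2) * ‖s‖ + 1 / 2 * (Λ * (a + e) * ‖s‖ ^ 2) ≤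
      Λ * (4 / 3 * ‖s‖ ^ 3 + 5 / 6 * (a ^ 3 + e ^ 3)) := by
    have : (a ^ 2 + e ^ 2) * ‖s‖ + 1 / 2 * ((a + e) * ‖s‖ ^ 2) ≤
      4 / 3 * ‖s‖ ^ 3 + 5 / 6 * (a ^ 3 + e ^ 3) := by linarith
    have := mul_le_mul_of_nonneg_left this hΦ.le
    linarith
  -- Both optimality conditions leave `-(3 * c / 2) * ‖s‖ ^ 3`, at most `-(55 / 4) * Λ * ‖s‖ ^ 3`.
  -- The errors add `4 / 3` from Young and `1 / 6` from the Taylor remainder, whence `-(49 / 4)`.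
  nlinarith

omit ha he in
/-- Gradient bound for the envelope after one inexact cubic step. -/
lemma norm_gradient_envelope_cubic_step_le : ‖gradient (envelope f) (x + s)‖ ≤
    LPhi L₁ L₂ μ * (57 / 2 * ‖s‖ ^ 2 + (a ^ 2 + e ^ 2) + (a + e) * ‖s‖) := by
  obtain ⟨-, hc2⟩ := cubic_coeff_bounds hL hL₂ hμ hη₁ hη₂
  have hη : 0 < ηx := lt_of_lt_of_le (by have := LPhi_pos hL hL₂ hμ; positivity) hη₁
  have hfo := cubic_first_order (h.schurG_isSymmetric hμ x y) hs
  have ht := norm_sub_sub_le_of_lipschitz_fderiv (h.hasFDerivAt_gradient_envelope hL hμ hn)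
    (h.norm_schurG_yStar_sub_le hL hL₂ hμ hn) x s
  have h2 := norm_grad1_sub_yStar_le h hg
  have h3 := ContinuousLinearMap.le_of_opNorm_le _ (norm_schurG_sub_yStar_le h hL hμ hG) s
  rw [h.gradient_envelope hL hμ hn]
  set Λ := LPhi L₁ L₂ μ
  set c := 1 / (6 * ηx) with hc
  have hc0 : 0 ≤ c := by positivity
  have h4 : ‖grad1 f x y + schurG f x y s‖ ≤ 28 * Λ * ‖s‖ ^ 2 := by
    rw [eq_neg_of_add_eq_zero_left hfo, norm_neg, norm_smul, Real.norm_of_nonneg (by positivity)]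
    have := mul_le_mul_of_nonneg_right hc2 (sq_nonneg ‖s‖)
    linarith
  -- Taylor remainder, gradient error, Hessian error, and the residual fixed by the first-order
  -- condition; the first and last give `1 / 2 + 28 = 57 / 2`.
  have he : grad1 f (x + s) (yStar f (x + s)) =
      (grad1 f (x + s) (yStar f (x + s)) - grad1 f x (yStar f x) - schurG f x (yStar f x) s)
      + (grad1 f x (yStar f x) - grad1 f x y) + (schurG f x (yStar f x) - schurG f x y) s
      + (grad1 f x y + schurG f x y s) := by
    rw [sub_apply]; abel
  change ‖grad1 f (x + s) (yStar f (x + s))‖ ≤ _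
  rw [he]
  refine norm_add₄_le.trans ?_
  linarith

omit ha he hg in
/-- Curvature bound for the envelope after one inexact cubic step. -/
lemma le_inner_hessian_envelope_cubic_step (w : E m) :
    -(LPhi L₁ L₂ μ * (29 * ‖s‖ + a + e)) * ‖w‖ ^ 2 ≤
      inner ℝ (hessian (envelope f) (x + s) w) w := by
  obtain ⟨-, hc2⟩ := cubic_coeff_bounds hL hL₂ hμ hη₁ hη₂
  have hso := cubic_second_order (h.schurG_isSymmetric hμ x y) hs w
  have h2 := h.norm_schurG_yStar_sub_le hL hL₂ hμ hn (x + s) x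
  have h3 := norm_schurG_sub_yStar_le h hL hμ hG
  rw [add_sub_cancel_left] at h2
  rw [h.hessian_envelope hL hμ hn]
  set Λ := LPhi L₁ L₂ μ
  have hb : ∀ {A B : E m →L[ℝ] E m} {b : ℝ}, ‖A - B‖ ≤ b →
      inner ℝ (B w) w - b * ‖w‖ ^ 2 ≤ inner ℝ (A w) w := by
    intro A B b hAB
    have h1 := (abs_le.1 ((abs_real_inner_le_norm ((A - B) w) w).trans
      (mul_le_mul_of_nonneg_right (ContinuousLinearMap.le_of_opNorm_le _ hAB w)
        (norm_nonneg w)))).1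
    rw [sub_apply, inner_sub_left] at h1
    linarith
  have b2 := hb h2
  have b3 := hb h3
  have h4 := mul_le_mul_of_nonneg_right (mul_le_mul_of_nonneg_right hc2 (norm_nonneg s))
    (sq_nonneg ‖w‖)
  linarith

end OneStep

/-! ### Analysis of a run up to the stopping index. -/

section Run

variable {m n : ℕ}

/-- The hypotheses on a run of Cubic-GDA under which its iterates are analysed. -/
structure AdmissibleRun (f : E m → E n → ℝ) (L₁ L₂ μ ηx e : ℝ) (N : ℕ → ℕ) (T : ℕ)
    (x : ℕ → E m) (y : ℕ → E n) (s : ℕ → E m) : Prop where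
  assumptions : Assumptions f L₁ L₂ μ
  L₁_pos : 0 < L₁
  L₂_pos : 0 < L₂
  μ_pos : 0 < μ
  n_pos : 0 < n
  e_pos : 0 < e
  LG_mul_le : LG L₁ L₂ μ * e ≤ L₁
  le_ηx : 1 / (56 * LPhi L₁ L₂ μ) ≤ ηx
  ηx_le : ηx ≤ 1 / (55 * LPhi L₁ L₂ μ)
  run : IsRun f ηx (2 / (L₁ + μ)) N T x y s
  req_le : ∀ t < T, (∀ j ≤ t, ¬ Stops e s j) →
    ascentReq L₁ L₂ μ (LPhi L₁ L₂ μ) (LPhi L₁ L₂ μ) e ‖y 0 - yStar f (x 0)‖ (stepNorm e s) t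
      ≤ (N t : ℝ)

namespace AdmissibleRun

variable {f : E m → E n → ℝ} {L₁ L₂ μ ηx e : ℝ} {N : ℕ → ℕ} {T : ℕ}
    {x : ℕ → E m} {y : ℕ → E n} {s : ℕ → E m} (h : AdmissibleRun f L₁ L₂ μ ηx e N T x y s)

include h

lemma LPhi_pos : 0 < LPhi L₁ L₂ μ := CubicGDA.LPhi_pos h.L₁_pos h.L₂_pos h.μ_pos

lemma LG_pos : 0 < LG L₁ L₂ μ := CubicGDA.LG_pos h.L₁_pos h.L₂_pos h.μ_pos

lemma stepNorm_nonneg (t : ℕ) : 0 ≤ stepNorm e s t := by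
  cases t
  · exact h.e_pos.le
  · exact norm_nonneg _

omit h in
lemma lt_max_of_not_stops {t : ℕ} (ht : ¬ Stops e s (t + 1)) :
    e < max (stepNorm e s t) (stepNorm e s (t + 1)) := by
  by_contra hc
  exact ht ⟨by omega, not_lt.1 hc⟩

lemma norm_ascent_sub_le {t : ℕ} (ht : t < T) : ‖y (t + 1) - yStar f (x t)‖ ≤
    Real.exp (-(N t / (L₁ / μ))) * ‖y t - yStar f (x t)‖ := by
  rw [h.run.ascent t ht]
  exact h.assumptions.norm_iterate_ascentStep_sub_le_exp h.L₁_pos h.μ_pos h.n_pos _ _ _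

/-- The inner loop is accurate enough as long as the run has not stopped. -/
lemma inner_accuracy (t : ℕ) (ht : t < T) (hns : ∀ j ≤ t, ¬ Stops e s j) :
    L₁ * ‖y (t + 1) - yStar f (x t)‖ ≤ LPhi L₁ L₂ μ * (stepNorm e s t ^ 2 + e ^ 2) ∧
      LG L₁ L₂ μ * ‖y (t + 1) - yStar f (x t)‖ ≤ LPhi L₁ L₂ μ * (stepNorm e s t + e) := by
  have hΦ := h.LPhi_pos
  have hG := h.LG_pos
  have hL := h.L₁_pos
  have hμ := h.μ_pos
  have he := h.e_pos
  have hκ : 0 < L₁ / μ := by positivity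
  have hLG := h.LG_mul_le
  induction t with
  | zero =>
    have h1 := h.norm_ascent_sub_le ht
    have hN := h.req_le 0 ht hns
    simp only [ascentReq] at hN
    simp only [stepNorm]
    set d := ‖y 0 - yStar f (x 0)‖
    set δ := ‖y (0 + 1) - yStar f (x 0)‖
    set Λ := LPhi L₁ L₂ μ
    have hδ : L₁ * δ ≤ Λ * (e ^ 2 + e ^ 2) := by
      rcases (show 0 ≤ d from norm_nonneg _).eq_or_lt with hd | hd
      · rw [← hd, mul_zero] at h1
        have : L₁ * δ ≤ 0 := mul_nonpos_of_nonneg_of_nonpos hL.le h1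
        exact this.trans (by positivity)
      · have h2 := exp_neg_div_le_inv hκ (by positivity) hN
        have h3 := h1.trans (mul_le_mul_of_nonneg_right h2 hd.le)
        have h4 : (L₁ * d / (2 * Λ * e ^ 2))⁻¹ * d = 2 * Λ * e ^ 2 / L₁ := by field_simp
        rw [h4, le_div_iff₀ hL] at h3
        linarith
    refine ⟨hδ, le_of_mul_le_mul_left ?_ hL⟩
    have h5 := mul_le_mul_of_nonneg_left hδ hG.le
    have h6 := mul_le_mul_of_nonneg_right hLG (by positivity : 0 ≤ Λ * (e + e))
    linarith
  | succ t ih =>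
    obtain ⟨-, ih2⟩ := ih (by omega) fun j hj => hns j (by omega)
    have h1 := h.norm_ascent_sub_le ht
    have hN := h.req_le (t + 1) ht hns
    simp only [ascentReq] at hN
    have hlt := lt_max_of_not_stops (hns (t + 1) le_rfl)
    have ha := h.stepNorm_nonneg t
    have hb := h.stepNorm_nonneg (t + 1)
    -- Not having stopped allows `e` in the inductive bound to be replaced by the sum of two
    -- increments. This produces the coefficients `2 * Λ` and `Λ + G * κ` in the required number of
    -- ascent steps.
    have hsum : e < stepNorm e s t + stepNorm e s (t + 1) :=
      hlt.trans_le (max_le (by linarith) (by linarith))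
    have hD : ‖y (t + 1) - yStar f (x (t + 1))‖ ≤
        ‖y (t + 1) - yStar f (x t)‖ + L₁ / μ * stepNorm e s (t + 1) := by
      refine (norm_sub_le_norm_sub_add_norm_sub _ (yStar f (x t)) _).trans ?_
      gcongr
      refine (h.assumptions.norm_yStar_sub_le hL hμ h.n_pos _ _).trans (le_of_eq ?_)
      rw [h.run.update t (by omega), norm_sub_rev, add_sub_cancel_left]
      rfl
    set a := stepNorm e s t
    set b := stepNorm e s (t + 1)
    set D := ‖y (t + 1) - yStar f (x (t + 1))‖
    set δ := ‖y (t + 1 + 1) - yStar f (x (t + 1))‖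
    set Λ := LPhi L₁ L₂ μ
    set G := LG L₁ L₂ μ
    set κ := L₁ / μ
    have hA : 0 < 2 * L₁ * Λ * a + L₁ * (Λ + G * κ) * b := by
      have h2 : 0 < L₁ * Λ * (a + b) := by have := he.trans hsum; positivity
      have h3 : 0 ≤ L₁ * Λ * a := by positivity
      have h4 : 0 ≤ L₁ * (G * κ) * b := by positivity
      linarith
    have h2 := exp_neg_div_le_inv hκ (by positivity) hN
    have hGD : L₁ * (G * D) ≤ 2 * L₁ * Λ * a + L₁ * (Λ + G * κ) * b := by
      have h3 := mul_le_mul_of_nonneg_left hD hG.le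
      have h4 : Λ * e ≤ Λ * (a + b) := mul_le_mul_of_nonneg_left hsum.le hΦ.le
      have h5 : G * D ≤ 2 * Λ * a + (Λ + G * κ) * b := by linarith
      have := mul_le_mul_of_nonneg_left h5 hL.le
      linarith
    have h3 := h1.trans (mul_le_mul_of_nonneg_right h2 (norm_nonneg _))
    have hδ : L₁ * δ ≤ Λ * e ^ 2 := by
      refine (mul_le_mul_of_nonneg_left h3 hL.le).trans ?_
      rw [inv_div, div_mul_eq_mul_div, mul_div_assoc', div_le_iff₀ hA]
      have := mul_le_mul_of_nonneg_left hGD (by positivity : 0 ≤ Λ * e ^ 2)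
      linarith
    constructor
    · have : 0 ≤ Λ * b ^ 2 := by positivity
      linarith
    -- The Hessian bound follows from the gradient bound because `G * e ≤ L₁`, which is where the
    -- upper limit on `ε` enters.
    · refine le_of_mul_le_mul_left ?_ hL
      have h5 := mul_le_mul_of_nonneg_left hδ hG.le
      have h6 := mul_le_mul_of_nonneg_right hLG (by positivity : 0 ≤ Λ * e)
      have h7 : 0 ≤ L₁ * (Λ * b) := by positivity
      linarith

lemma envelope_step_le {t : ℕ} (ht : t < T) (hns : ∀ j ≤ t, ¬ Stops e s j) :
    envelope f (x (t + 1)) ≤ envelope f (x t) + LPhi L₁ L₂ μ *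
      (-(49 / 4) * stepNorm e s (t + 1) ^ 3 + 5 / 6 * (stepNorm e s t ^ 3 + e ^ 3)) := by
  obtain ⟨h1, h2⟩ := h.inner_accuracy t ht hns
  rw [h.run.update t ht]
  exact envelope_cubic_step_le h.assumptions h.L₁_pos h.L₂_pos h.μ_pos h.n_pos
    (h.stepNorm_nonneg t) h.e_pos.le h.le_ηx h.ηx_le (h.run.cubic t ht) h1 h2

lemma optVal_le (x : E m) : optVal f ≤ envelope f x := ciInf_le h.assumptions.bddBelow x

lemma sum_cubes_le {K : ℕ} (hK : K ≤ T) (hns : ∀ j ≤ K, ¬ Stops e s j) :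
    K * e ^ 3 ≤ 2 * ∑ t ∈ Finset.range K, stepNorm e s (t + 1) ^ 3 ∧
      8 * LPhi L₁ L₂ μ * ∑ t ∈ Finset.range K, stepNorm e s (t + 1) ^ 3 ≤
        envelope f (x 0) - optVal f := by
  have := sum_cubes_le_of_descent (φ := fun t => envelope f (x t)) h.LPhi_pos h.e_pos
    h.stepNorm_nonneg rfl
    (fun t ht => h.envelope_step_le (ht.trans_le hK) fun j hj => hns j (by omega))
    (fun t ht => lt_max_of_not_stops (hns (t + 1) (by omega)))
  exact ⟨this.1, this.2.trans (sub_le_sub_left (h.optVal_le _) _)⟩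

lemma card_mul_le {K : ℕ} (hK : K ≤ T) (hns : ∀ j ≤ K, ¬ Stops e s j) :
    4 * LPhi L₁ L₂ μ * e ^ 3 * K ≤ envelope f (x 0) - optVal f := by
  obtain ⟨h1, h2⟩ := h.sum_cubes_le hK hns
  have := mul_le_mul_of_nonneg_left h1 h.LPhi_pos.le
  linarith

lemma stepNorm_cube_le {K : ℕ} (hK : K ≤ T) (hns : ∀ j ≤ K, ¬ Stops e s j) {t : ℕ} (ht : t < K) :
    8 * LPhi L₁ L₂ μ * stepNorm e s (t + 1) ^ 3 ≤ envelope f (x 0) - optVal f := by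
  refine le_trans ?_ (h.sum_cubes_le hK hns).2
  have := h.LPhi_pos
  gcongr
  exact Finset.single_le_sum (f := fun t => stepNorm e s (t + 1) ^ 3)
    (fun t _ => pow_nonneg (h.stepNorm_nonneg _) 3) (Finset.mem_range.2 ht)

/-- The stopping criterion is met within the iteration budget. -/
lemma exists_stops (hT : (envelope f (x 0) - optVal f + 8 * LPhi L₁ L₂ μ * e ^ 2) /
    (3 * LPhi L₁ L₂ μ * e ^ 3) ≤ (T : ℝ)) : ∃ t ≤ T, Stops e s t := by
  by_contra! hc
  have hΦ := h.LPhi_pos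
  have he := h.e_pos
  have h1 := h.card_mul_le le_rfl hc
  rw [div_le_iff₀ (by positivity)] at hT
  have h2 : 0 < 8 * LPhi L₁ L₂ μ * e ^ 2 := by positivity
  have h3 : 0 ≤ LPhi L₁ L₂ μ * e ^ 3 * T := by positivity
  linarith

/-- The iterate at a first stopping index is approximately second-order stationary. -/
lemma stationarity_le {t : ℕ} (ht : t < T) (hns : ∀ j ≤ t, ¬ Stops e s j)
    (hst : Stops e s (t + 1)) {ε : ℝ} (hε : 0 ≤ ε) (he : e = ε / √(33 * LPhi L₁ L₂ μ)) :
    stationarity f (LPhi L₁ L₂ μ) (x (t + 1)) ≤ ε := by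
  obtain ⟨h1, h2⟩ := h.inner_accuracy t ht hns
  have hΦ := h.LPhi_pos
  have he0 := h.e_pos
  have ha : stepNorm e s t ≤ e := (le_max_left _ _).trans hst.2
  have hb : ‖s (t + 1)‖ ≤ e := (le_max_right _ _).trans hst.2
  have ha0 := h.stepNorm_nonneg t
  have hb0 := norm_nonneg (s (t + 1))
  have hg := norm_gradient_envelope_cubic_step_le h.assumptions h.L₁_pos h.L₂_pos h.μ_pos h.n_pos
    h.le_ηx h.ηx_le (h.run.cubic t ht) h1 h2
  have hH := le_inner_hessian_envelope_cubic_step h.assumptions h.L₁_pos h.L₂_pos h.μ_pos h.n_pos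
    h.le_ηx h.ηx_le (h.run.cubic t ht) h2
  rw [← h.run.update t ht] at hg hH
  set Λ := LPhi L₁ L₂ μ
  set a := stepNorm e s t
  set b := ‖s (t + 1)‖
  have hsq : 0 < √(33 * Λ) := by positivity
  have hεe : ε = e * √(33 * Λ) := by rw [he]; field_simp
  refine max_le ?_ ?_
  · rw [Real.sqrt_le_left hε]
    refine hg.trans ?_
    have e1 : ε ^ 2 = Λ * (33 * e ^ 2) := by
      rw [hεe, mul_pow, Real.sq_sqrt (by positivity)]; ring
    rw [e1]
    gcongr
    -- With both increments at most `e` the total is `57 / 2 + 2 + 2 ≤ 33`; the curvature bound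
    -- below needs only `29 + 2`.
    nlinarith [pow_le_pow_left₀ ha0 ha 2, pow_le_pow_left₀ hb0 hb 2,
      mul_le_mul (add_le_add_left ha e) hb hb0 (by linarith)]
  · rw [div_le_iff₀ hsq]
    have e1 : ε * √(33 * Λ) = Λ * (33 * e) := by
      rw [hεe, mul_assoc, Real.mul_self_sqrt (by positivity)]; ring
    rw [e1, neg_le]
    -- The second argument covers an empty set of eigenvalues, whose infimum is zero by default.
    refine Real.le_sInf (fun c hc => ?_) (by
      have : 0 ≤ Λ * (33 * e) := by positivity
      linarith)
    obtain ⟨v, hv⟩ := Module.End.HasEigenvalue.exists_hasEigenvector hc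
    have hv0 : 0 < ‖v‖ ^ 2 := by have := norm_pos_iff.2 hv.2; positivity
    have h3 := hH v
    have h4 : hessian (envelope f) (x (t + 1)) v = c • v := hv.apply_eq_smul
    rw [h4, inner_smul_left, real_inner_self_eq_norm_sq, conj_trivial] at h3
    have h5 := le_of_mul_le_mul_right h3 hv0
    refine le_trans ?_ h5
    rw [neg_le_neg_iff]
    gcongr
    linarith

end AdmissibleRun

end Run

/-! ### Complexity bounds. -/

lemma log_le_mul_log_of_le_pow {A M : ℝ} (hM : 1 ≤ M) (hA : 0 ≤ A) {k : ℕ} (h : A ≤ M ^ k) :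
    Real.log A ≤ k * Real.log M := by
  rcases hA.eq_or_lt with rfl | hA
  · rw [Real.log_zero]
    exact mul_nonneg k.cast_nonneg (Real.log_nonneg hM)
  · rw [← Real.log_pow]
    exact Real.log_le_log hA h

lemma natCeil_mul_log_le {κ A M : ℝ} (hκ : 1 ≤ κ) (hM : 2 ≤ M) (hA : 0 ≤ A) {k : ℕ}
    (h : A ≤ M ^ k) : (⌈κ * Real.log A⌉₊ : ℝ) ≤ (k + 2) * (κ * Real.log M) := by
  have hlog : 1 / 2 ≤ Real.log M := by
    have := Real.log_le_log two_pos hM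
    linarith [Real.log_two_gt_d9]
  have h1 : κ * Real.log A ≤ k * (κ * Real.log M) := by
    have := mul_le_mul_of_nonneg_left (log_le_mul_log_of_le_pow (by linarith) hA h)
      (by linarith : 0 ≤ κ)
    linarith
  have h2 : (⌈κ * Real.log A⌉₊ : ℝ) ≤ ⌈k * (κ * Real.log M)⌉₊ := by
    exact_mod_cast Nat.ceil_le_ceil h1
  have h3 := Nat.ceil_lt_add_one (a := k * (κ * Real.log M)) (by positivity)
  -- The rounding error `1` is absorbed as `2 * (κ * Real.log M)`, which explains `k + 2`.
  have h4 : 1 / 2 ≤ κ * Real.log M := by nlinarith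
  linarith

lemma sq_rpow_three_halves {κ : ℝ} (hκ : 0 ≤ κ) : (κ ^ (3 / 2 : ℝ)) ^ 2 = κ ^ 3 := by
  rw [← Real.rpow_natCast, ← Real.rpow_mul hκ, ← Real.rpow_natCast]
  norm_num

lemma sqrt_LPhi_le {L₁ L₂ μ : ℝ} (hL₂ : 0 < L₂) (hκ : 1 ≤ L₁ / μ) :
    √(33 * LPhi L₁ L₂ μ) ≤ 17 * (√L₂ * (L₁ / μ) ^ (3 / 2 : ℝ)) := by
  rw [Real.sqrt_le_iff]
  refine ⟨by positivity, ?_⟩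
  rw [mul_pow, mul_pow, Real.sq_sqrt hL₂.le, sq_rpow_three_halves (by linarith), LPhi]
  have h1 : (1 + L₁ / μ) ^ 3 ≤ (2 * (L₁ / μ)) ^ 3 :=
    pow_le_pow_left₀ (by linarith) (by linarith) 3
  have h2 := mul_le_mul_of_nonneg_left h1 hL₂.le
  have h3 : 0 ≤ L₂ * (L₁ / μ) ^ 3 := by positivity
  linarith

namespace AdmissibleRun

variable {m n : ℕ} {f : E m → E n → ℝ} {L₁ L₂ μ ηx e : ℝ} {N : ℕ → ℕ} {T : ℕ}
    {x : ℕ → E m} {y : ℕ → E n} {s : ℕ → E m} (h : AdmissibleRun f L₁ L₂ μ ηx e N T x y s)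
    {K : ℕ} (hK : K ≤ T) (hns : ∀ j ≤ K, ¬ Stops e s j) {ε : ℝ} (hε : 0 < ε)
    (he : e = ε / √(33 * LPhi L₁ L₂ μ))

include h

lemma one_le_kappa : 1 ≤ L₁ / μ :=
  (one_le_div h.μ_pos).2 (h.assumptions.mu_le h.L₁_pos.le h.n_pos)

include hK hns hε he in
/-- The number of cubic iterations before the stopping criterion is met. -/
lemma card_le : (K : ℝ) ≤ 141 *
    ((envelope f (x 0) - optVal f) * (√L₂ * (L₁ / μ) ^ (3 / 2 : ℝ) * ε⁻¹ ^ 3)) := by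
  have hΦ := h.LPhi_pos
  have h1 := h.card_mul_le hK hns
  have hsq : 0 < √(33 * LPhi L₁ L₂ μ) := by positivity
  have hΔ : 0 ≤ envelope f (x 0) - optVal f := sub_nonneg.2 (h.optVal_le _)
  have h2 := sqrt_LPhi_le (μ := μ) h.L₂_pos h.one_le_kappa
  set Δ := envelope f (x 0) - optVal f
  set Λ := LPhi L₁ L₂ μ
  have h3 : Λ * e ^ 3 * (33 * √(33 * Λ)) = ε ^ 3 := by
    have hsq2 : √(33 * Λ) ^ 2 = 33 * Λ := Real.sq_sqrt (by positivity)
    calc Λ * e ^ 3 * (33 * √(33 * Λ)) = (33 * Λ) * e ^ 3 * √(33 * Λ) := by ring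
      _ = (e * √(33 * Λ)) ^ 3 := by rw [mul_pow, pow_succ √(33 * Λ) 2, hsq2]; ring
      _ = ε ^ 3 := by rw [he]; field_simp
  have h4 : 4 * K * ε ^ 3 ≤ Δ * (33 * √(33 * Λ)) := by
    rw [← h3]
    have := mul_le_mul_of_nonneg_right h1 (by positivity : 0 ≤ 33 * √(33 * Λ))
    linarith
  -- The constant comes from `33 * 17 / 4 ≤ 141`.
  have h5 : K * ε ^ 3 ≤ 141 * (Δ * (√L₂ * (L₁ / μ) ^ (3 / 2 : ℝ))) := by
    have h6 := mul_le_mul_of_nonneg_left h2 hΔ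
    have : 0 ≤ Δ * (√L₂ * (L₁ / μ) ^ (3 / 2 : ℝ)) := by
      have := h.L₁_pos; have := h.μ_pos; positivity
    linarith
  rw [← le_div_iff₀ (by positivity)] at h5
  refine h5.trans (le_of_eq ?_)
  rw [inv_pow]
  ring

section Log

variable {M : ℝ} (hM : M = 2 + L₁ + L₂⁻¹ + L₁ / μ + ε⁻¹ + (envelope f (x 0) - optVal f)
  + ‖y 0 - yStar f (x 0)‖)

include hε hM

lemma le_logArg : 2 ≤ M ∧ L₁ ≤ M ∧ L₂⁻¹ ≤ M ∧ 2 + L₁ / μ ≤ M ∧ ε⁻¹ ≤ M ∧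
    envelope f (x 0) - optVal f ≤ M ∧ ‖y 0 - yStar f (x 0)‖ ≤ M := by
  have h1 := h.L₁_pos
  have h2 := inv_pos.2 h.L₂_pos
  have h3 := h.one_le_kappa
  have h4 := inv_pos.2 hε
  have h5 : 0 ≤ envelope f (x 0) - optVal f := sub_nonneg.2 (h.optVal_le _)
  have h6 := norm_nonneg (y 0 - yStar f (x 0))
  refine ⟨?_, ?_, ?_, ?_, ?_, ?_, ?_⟩ <;> linarith

include hK hns

/-- The increments occur inside the logarithm of the ascent requirement, so they need an a priori
bound. For `t = 0` it comes from the upper limit on `e`, for later `t` from the sum of cubes. -/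
lemma stepNorm_le_sq {t : ℕ} (ht : t ≤ K) : stepNorm e s t ≤ M ^ 2 := by
  obtain ⟨h2, hL, hL₂, -, -, hΔ, -⟩ := h.le_logArg hε hM
  have hκ := h.one_le_kappa
  have hL₁p := h.L₁_pos
  have hL₂p := h.L₂_pos
  have hmul : ∀ {a b : ℝ}, 0 ≤ a → a ≤ M → L₂ * b ≤ a → b ≤ M ^ 2 := by
    intro a b ha haM hb
    have h3 : b ≤ L₂⁻¹ * a := by rwa [inv_mul_eq_div, le_div_iff₀ hL₂p, mul_comm]
    refine h3.trans ?_
    rw [sq]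
    exact mul_le_mul hL₂ haM ha (by linarith)
  cases t with
  | zero =>
    refine hmul hL₁p.le hL (le_trans ?_ h.LG_mul_le)
    refine mul_le_mul_of_nonneg_right ?_ h.e_pos.le
    exact le_mul_of_one_le_right hL₂p.le (one_le_pow₀ (by linarith))
  | succ t =>
    have h1 := h.stepNorm_cube_le hK hns ht
    have hr := h.stepNorm_nonneg (t + 1)
    have h3 : L₂ ≤ 8 * LPhi L₁ L₂ μ := by
      have : L₂ ≤ LPhi L₁ L₂ μ :=
        le_mul_of_one_le_right hL₂p.le (one_le_pow₀ (by linarith))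
      linarith
    have h4 : stepNorm e s (t + 1) ^ 3 ≤ M ^ 2 :=
      hmul (sub_nonneg.2 (h.optVal_le _)) hΔ
        ((mul_le_mul_of_nonneg_right h3 (pow_nonneg hr 3)).trans h1)
    have h5 : M ^ 2 ≤ (M ^ 2) ^ 3 := le_self_pow₀ (one_le_pow₀ (by linarith)) (by norm_num)
    exact le_of_pow_le_pow_left₀ (by norm_num) (by positivity) (h4.trans h5)

include he

lemma natCeil_ascentReq_le {t : ℕ} (ht : t ≤ K) :
    (⌈ascentReq L₁ L₂ μ (LPhi L₁ L₂ μ) (LPhi L₁ L₂ μ) e ‖y 0 - yStar f (x 0)‖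
      (stepNorm e s) t⌉₊ : ℝ) ≤ 16 * (L₁ / μ * Real.log M) := by
  obtain ⟨h2, hL, -, hκM, hεM, -, hd⟩ := h.le_logArg hε hM
  have hκ := h.one_le_kappa
  have hL₁p := h.L₁_pos
  have hμp := h.μ_pos
  have hG := h.LG_pos
  have hΦ := h.LPhi_pos
  have hep := h.e_pos
  have hM0 : 0 < M := by linarith
  have hpow : ∀ k : ℕ, (2 : ℝ) ^ k ≤ M ^ k := fun k => pow_le_pow_left₀ two_pos.le h2 k
  have hΛ : LPhi L₁ L₂ μ * e ^ 2 = ε ^ 2 / 33 := by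
    rw [he, div_pow, Real.sq_sqrt (by positivity)]
    field_simp
  have hε2 : (ε ^ 2)⁻¹ ≤ M ^ 2 := by
    rw [← inv_pow]
    exact pow_le_pow_left₀ (by positivity) hεM 2
  -- The exponent `14` serves both cases: numerical constants are absorbed as powers of `2 ≤ M`, and
  -- `16 = 14 + 2`.
  have hfin : ∀ {A : ℝ}, 0 ≤ A → A ≤ M ^ 14 →
      (⌈L₁ / μ * Real.log A⌉₊ : ℝ) ≤ 16 * (L₁ / μ * Real.log M) := by
    intro A hA hAM
    refine (natCeil_mul_log_le hκ h2 hA hAM).trans (le_of_eq ?_)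
    norm_num
  cases t with
  | zero =>
    refine hfin (by positivity) ?_
    have e1 : L₁ * ‖y 0 - yStar f (x 0)‖ / (2 * LPhi L₁ L₂ μ * e ^ 2) =
        33 / 2 * (L₁ * ‖y 0 - yStar f (x 0)‖ * (ε ^ 2)⁻¹) := by
      rw [mul_assoc 2, hΛ]
      field_simp
    rw [e1]
    calc 33 / 2 * (L₁ * ‖y 0 - yStar f (x 0)‖ * (ε ^ 2)⁻¹)
        ≤ 2 ^ 10 * (M * M * M ^ 2) := by gcongr; norm_num
      _ ≤ M ^ 10 * (M * M * M ^ 2) := by gcongr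
      _ = M ^ 14 := by ring
  | succ t =>
    have ha := h.stepNorm_le_sq hK hns hε hM (t := t) (by omega)
    have hb := h.stepNorm_le_sq hK hns hε hM ht
    have ha0 := h.stepNorm_nonneg t
    have hb0 := h.stepNorm_nonneg (t + 1)
    have hLΦ : LPhi L₁ L₂ μ = LG L₁ L₂ μ * (1 + L₁ / μ) := by
      rw [LPhi, LG]; ring
    refine hfin (by positivity) ?_
    have e1 : (2 * L₁ * LPhi L₁ L₂ μ * stepNorm e s t + L₁ * (LPhi L₁ L₂ μ +
        LG L₁ L₂ μ * (L₁ / μ)) * stepNorm e s (t + 1)) / (LG L₁ L₂ μ * LPhi L₁ L₂ μ * e ^ 2) =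
        33 * (L₁ * (2 * (1 + L₁ / μ) * stepNorm e s t +
          (1 + 2 * (L₁ / μ)) * stepNorm e s (t + 1)) * (ε ^ 2)⁻¹) := by
      rw [mul_assoc (LG L₁ L₂ μ), hΛ, hLΦ]
      field_simp
      ring
    have h3 : 2 * (1 + L₁ / μ) * stepNorm e s t + (1 + 2 * (L₁ / μ)) * stepNorm e s (t + 1) ≤
        4 * M * M ^ 2 := by
      calc _ ≤ 2 * (1 + L₁ / μ) * M ^ 2 + (1 + 2 * (L₁ / μ)) * M ^ 2 := by gcongr
        _ = (3 + 4 * (L₁ / μ)) * M ^ 2 := by ring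
        _ ≤ _ := by gcongr; linarith
    rw [e1]
    calc 33 * (L₁ * (2 * (1 + L₁ / μ) * stepNorm e s t +
          (1 + 2 * (L₁ / μ)) * stepNorm e s (t + 1)) * (ε ^ 2)⁻¹)
        ≤ 33 * (M * (4 * M * M ^ 2) * M ^ 2) := by gcongr
      _ = 132 * M ^ 6 := by ring
      _ ≤ 2 ^ 8 * M ^ 6 := by gcongr; norm_num
      _ ≤ M ^ 8 * M ^ 6 := by gcongr
      _ = M ^ 14 := by ring

end Log

end AdmissibleRun

end CubicGDA

theorem theorem1 :
    ∃ C : ℝ, 0 < C ∧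
      ∀ (m n : ℕ), 0 < m → 0 < n →
      ∀ (f : CubicGDA.E m → CubicGDA.E n → ℝ) (L₁ L₂ μ : ℝ), 0 < L₁ → 0 < L₂ → 0 < μ →
      CubicGDA.Assumptions f L₁ L₂ μ →
      ∀ (κ LG LΦ ε ε' ηx ηy d₀ Δ : ℝ) (N : ℕ → ℕ) (T : ℕ)
        (x : ℕ → CubicGDA.E m) (y : ℕ → CubicGDA.E n) (s : ℕ → CubicGDA.E m) (req : ℕ → ℝ),
      κ = L₁ / μ →
      LG = CubicGDA.LG L₁ L₂ μ →
      LΦ = CubicGDA.LPhi L₁ L₂ μ →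
      0 < ε → ε ≤ L₁ * Real.sqrt (33 * LΦ) / LG →
      ε' = ε / Real.sqrt (33 * LΦ) →
      1 / (56 * LΦ) ≤ ηx → ηx ≤ 1 / (55 * LΦ) →
      ηy = 2 / (L₁ + μ) →
      d₀ = ‖y 0 - CubicGDA.yStar f (x 0)‖ →
      Δ = CubicGDA.envelope f (x 0) - CubicGDA.optVal f →
      req = CubicGDA.ascentReq L₁ L₂ μ LΦ LΦ ε' d₀ (CubicGDA.stepNorm ε' s) →
      (Δ + 8 * LΦ * ε' ^ 2) / (3 * LΦ * ε' ^ 3) ≤ (T : ℝ) →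
      CubicGDA.IsRun f ηx ηy N T x y s →
      (∀ t < T, (∀ j ≤ t, ¬ CubicGDA.Stops ε' s j) → req t ≤ (N t : ℝ)) →
      ∃ T' : ℕ, IsLeast {t : ℕ | CubicGDA.Stops ε' s t} T' ∧ T' ≤ T ∧
        CubicGDA.stationarity f LΦ (x T') ≤ ε ∧
        (T' : ℝ) ≤ C * (1 + Δ * (Real.sqrt L₂ * κ ^ (3 / 2 : ℝ) * ε⁻¹ ^ 3)) ∧
        ((∀ t < T', N t = ⌈req t⌉₊) →
          ((∑ t ∈ Finset.range T', N t : ℕ) : ℝ) ≤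
            C * (κ + Δ * (Real.sqrt L₂ * κ ^ (5 / 2 : ℝ) * ε⁻¹ ^ 3)) *
              Real.log (2 + L₁ + L₂⁻¹ + κ + ε⁻¹ + Δ + d₀)) := by
  -- `2256 = 141 * 16`, the iteration constant times the cost constant of one inner loop.
  refine ⟨2256, by norm_num, ?_⟩
  intro m n _ hn f L₁ L₂ μ hL₁ hL₂ hμ hf κ LG LΦ ε ε' ηx ηy d₀ Δ N T x y s req hκ hLG hLΦ hε hεle
    hε' hη₁ hη₂ hηy hd₀ hΔ hreq hT hrun hN
  subst hκ hLG hLΦ hηy hd₀ hΔ hreq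
  have hΦ := CubicGDA.LPhi_pos hL₁ hL₂ hμ
  have hG := CubicGDA.LG_pos hL₁ hL₂ hμ
  have hsq : 0 < √(33 * CubicGDA.LPhi L₁ L₂ μ) := by positivity
  have hLGε : CubicGDA.LG L₁ L₂ μ * ε' ≤ L₁ := by
    rw [le_div_iff₀ hG] at hεle
    rw [hε', mul_div_assoc', div_le_iff₀ hsq]
    linarith
  have h : CubicGDA.AdmissibleRun f L₁ L₂ μ ηx ε' N T x y s :=
    ⟨hf, hL₁, hL₂, hμ, hn, by rw [hε']; positivity, hLGε, hη₁, hη₂, hrun, hN⟩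
  obtain ⟨t₀, ht₀, hst₀⟩ := h.exists_stops hT
  classical
  have hex : ∃ t, CubicGDA.Stops ε' s t := ⟨t₀, hst₀⟩
  -- The stopping index is at least `1`. The counting lemmas apply up to its predecessor `K`, and
  -- the one remaining iteration accounts for the summands `1` and `κ` in the two bounds.
  obtain ⟨K, hKeq⟩ : ∃ K, Nat.find hex = K + 1 :=
    Nat.exists_eq_add_of_le' (Nat.find_spec hex).1
  have hst : CubicGDA.Stops ε' s (K + 1) := hKeq ▸ Nat.find_spec hex
  have hns : ∀ j ≤ K, ¬ CubicGDA.Stops ε' s j := fun j hj => Nat.find_min hex (by omega)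
  have hKT : K + 1 ≤ T := hKeq ▸ (Nat.find_min' hex hst₀).trans ht₀
  have hcard := h.card_le (by omega) hns hε hε'
  have hκ1 := h.one_le_kappa
  have hΔ0 : 0 ≤ CubicGDA.envelope f (x 0) - CubicGDA.optVal f := sub_nonneg.2 (h.optVal_le _)
  have hX : 0 ≤ (CubicGDA.envelope f (x 0) - CubicGDA.optVal f) *
      (√L₂ * (L₁ / μ) ^ (3 / 2 : ℝ) * ε⁻¹ ^ 3) := by positivity
  refine ⟨K + 1, ⟨hst, fun j hj => ?_⟩, hKT, h.stationarity_le hKT hns hst hε.le hε', ?_, ?_⟩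
  · by_contra hlt
    exact hns j (by omega) hj
  · push_cast
    linarith
  · intro hNeq
    have hlog := h.le_logArg hε rfl
    set M := 2 + L₁ + L₂⁻¹ + L₁ / μ + ε⁻¹ + (CubicGDA.envelope f (x 0) - CubicGDA.optVal f)
      + ‖y 0 - CubicGDA.yStar f (x 0)‖ with hM
    have hlog0 : 0 ≤ Real.log M := Real.log_nonneg (by linarith [hlog.1])
    have hsum : ((∑ t ∈ Finset.range (K + 1), N t : ℕ) : ℝ) ≤
        (K + 1) * (16 * (L₁ / μ * Real.log M)) := by
      push_cast
      refine (Finset.sum_le_card_nsmul _ _ (16 * (L₁ / μ * Real.log M)) fun t ht => ?_).trans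
        (le_of_eq ?_)
      · have ht' := Finset.mem_range.1 ht
        rw [hNeq t ht']
        exact h.natCeil_ascentReq_le (by omega) hns hε hε' hM (by omega)
      · simp
    have hpow : (L₁ / μ) ^ (5 / 2 : ℝ) = (L₁ / μ) ^ (3 / 2 : ℝ) * (L₁ / μ) := by
      rw [← Real.rpow_add_one (by positivity)]
      norm_num
    rw [hpow]
    have hκℓ : 0 ≤ L₁ / μ * Real.log M := by positivity
    have h1 := mul_le_mul_of_nonneg_right hcard hκℓ
    linarith
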